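/- **Setting.** Let $\mathcal X\subset\mathbb R^d$ and $\mathcal Y\subset\mathbb R^{d'}$ be nonempty compact convex sets, $\mathbb P$ a probability measure on $\mathcal Z$, and $f:\mathcal X\times\mathcal Y\times\mathcal Z\to\mathbb R$ with $f(\mathbf x,\mathbf y;\cdot)$ integrable for all $(\mathbf x,\mathbf y)$. Let $\mu_{\mathbf y},\beta>0$ and assume that for every $\mathbf z$: * $f(\cdot,\cdot;\mathbf z)$ is continuously differentiable on $\mathcal X\times\mathcal Y$ and its gradient $(\nabla_{\mathbf x}f,\nabla_{\mathbf y}f)$ is $\beta$-Lipschitz on $\mathcal X\times\mathcal Y$ (Euclidean norms); * $f(\mathbf x,\cdot;\mathbf z)$ is $\mu_{\mathbf y}$-strongly concave on $\mathcal Y$ for every $\mathbf x\in\mathcal X$. (Gradients on $\mathcal X$ and $\mathcal Y$ are taken relative to these sets, at boundary points one-sidedly; if a set has empty interior, within its affine hull.) For an i.i.d. sample $S=(\mathbf z_1,\dots,\mathbf z_n)\sim\mathbb P^n$ put $$F(\mathbf x,\mathbf y)=\mathbb E_{\mathbf z\sim\mathbb P}f(\mathbf x,\mathbf y;\mathbf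 z),\qquad F_S(\mathbf x,\mathbf y)=\frac1n\sum_{i=1}^n f(\mathbf x,\mathbf y;\mathbf z_i),$$ $$\Phi(\mathbf x)=\max_{\mathbf y\in\mathcal Y}F(\mathbf x,\mathbf y),\qquad \Phi_S(\mathbf x)=\max_{\mathbf y\in\mathcal Y}F_S(\mathbf x,\mathbf y).$$ Let $(\mathbf x^*,\mathbf y^*)$ be a solution of $\min_{\mathbf x\in\mathcal X}\max_{\mathbf y\in\mathcal Y}F(\mathbf x,\mathbf y)$, and assume that there are $B_{\mathbf x^*},B_{\mathbf y^*}>0$ such that for all integers $k\ge2$ the following moments are finite and $$\mathbb E\|\nabla_{\mathbf x}f(\mathbf x^*,\mathbf y^*;\mathbf z)\|^k\le\frac{k!}2\,\mathbb E\|\nabla_{\mathbf x}f(\mathbf x^*,\mathbf y^*;\mathbf z)\|^2\,B_{\mathbf x^*}^{k-2},\qquad \mathbb E\|\nabla_{\mathbf y}f(\mathbf x^*,\mathbf y^*;\mathbf z)\|^k\le\frac{k!}2\,\mathbb E\|\nabla_{\mathbf y}f(\mathbf x^*,\mathbf y^*;\mathbf z)\|^2\,B_{\mathbf y^*}^{k-2}.$$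 Let $R_1$ be such that $\|\mathbf x-\mathbf x^*\|\le R_1$ for all $\mathbf x\in\mathcal X$, and $\sqrt2R_1n\ge1$. **Theorem 1.** There is an absolute constant $C>0$ such that in every such setting and for every $\delta\in(0,1)$, with probability at least $1-\delta$ over $S$, for all $\mathbf x\in\mathcal X$ the functions $\Phi$ and $\Phi_S$ are differentiable at $\mathbf x$ and $$\begin{aligned}\|\nabla\Phi(\mathbf x)-\nabla\Phi_S(\mathbf x)\|\le{}&\frac{\beta}{\mu_{\mathbf y}}\left(\sqrt{\frac{2\,\mathbb E\|\nabla_{\mathbf y}f(\mathbf x^*,\mathbf y^*;\mathbf z)\|^2\log\frac8\delta}{n}}+\frac{B_{\mathbf y^*}\log\frac8\delta}{n}\right)\\&+\sqrt{\frac{2\,\mathbb E\|\nabla_{\mathbf x}f(\mathbf x^*,\mathbf y^*;\mathbf z)\|^2\log\frac8\delta}{n}}+\frac{B_{\mathbf x^*}\log\frac8\delta}{n}\\&+\frac{C\beta(\mu_{\mathbf y}+\beta)}{\mu_{\mathbf y}}\cdot\frac{\mu_{\mathbf y}+\beta}{\mu_{\mathbf y}}\,\max\left\{\|\mathbf x-\mathbf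 x^*\|,\frac1n\right\}\left(\sqrt{\frac{d+\log\frac{16\log_2(\sqrt2R_1n+1)}{\delta}}{n}}+\frac{d+\log\frac{16\log_2(\sqrt2R_1n+1)}{\delta}}{n}\right).\end{aligned}$$ -/

import Mathlib

open MeasureTheory

namespace Minimax

section Gradient

variable {E : Type*} [NormedAddCommGroup E] [InnerProductSpace ℝ E] [CompleteSpace E]

/-- `g` is the gradient at `x` of the function `f` living on the convex set `s`: the derivative of
`f` at `x` relative to `s` is `⟪g, ·⟫`, and `g` lies in the linear span of the directions of `s`.
When `s` has nonempty interior the last requirement is void (the span is the whole space) and this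
is the usual gradient; it makes the gradient unique when `s` lies in a proper affine subspace. -/
def HasGradOn (f : E → ℝ) (s : Set E) (g : E) (x : E) : Prop :=
  g ∈ vectorSpan ℝ s ∧ HasGradientWithinAt f g s x

theorem HasGradOn.unique {f : E → ℝ} {s : Set E} {g₁ g₂ x : E} (hs : Convex ℝ s) (hx : x ∈ s)
    (h₁ : HasGradOn f s g₁ x) (h₂ : HasGradOn f s g₂ x) : g₁ = g₂ := by
  have key : ∀ y ∈ s, inner ℝ (g₁ - g₂) (y - x) = 0 := by
    intro y hy
    have := h₁.2.hasFDerivWithinAt.unique_on h₂.2.hasFDerivWithinAt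
      (mem_tangentConeAt_of_segment_subset (hs.segment_subset hx hy))
    simp only [InnerProductSpace.toDual_apply_apply] at this
    rw [inner_sub_left, this, sub_self]
  have hmem : g₁ - g₂ ∈ vectorSpan ℝ s := Submodule.sub_mem _ h₁.1 h₂.1
  have hall : ∀ v ∈ vectorSpan ℝ s, inner ℝ (g₁ - g₂) v = 0 := by
    intro v hv
    rw [vectorSpan_eq_span_vsub_set_right ℝ hx] at hv
    induction hv using Submodule.span_induction with
    | mem v hv =>
      obtain ⟨y, hy, rfl⟩ := hv
      exact key y hy
    | zero => simp
    | add u v _ _ hu hv => rw [inner_add_right, hu, hv, add_zero]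
    | smul a u _ hu => rw [inner_smul_right, hu, mul_zero]
  exact sub_eq_zero.1 (inner_self_eq_zero.1 (hall _ hmem))

end Gradient

section Problem

variable {E : Type*} [NormedAddCommGroup E] [InnerProductSpace ℝ E] [CompleteSpace E]
  {E' : Type*} [NormedAddCommGroup E'] [InnerProductSpace ℝ E'] [CompleteSpace E']
  {Z : Type*}

/-- The population risk `F(x, y) = 𝔼 f(x, y; z)`. -/
noncomputable def popRisk [MeasurableSpace Z] (P : Measure Z) (f : E → E' → Z → ℝ)
    (x : E) (y : E') : ℝ :=
  ∫ z, f x y z ∂P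

/-- The empirical risk `F_S(x, y) = (1/n) ∑ᵢ f(x, y; zᵢ)` of a sample `S = (z₁, …, zₙ)`. -/
noncomputable def empRisk {n : ℕ} (f : E → E' → Z → ℝ) (S : Fin n → Z) (x : E) (y : E') : ℝ :=
  (1 / (n : ℝ)) * ∑ i, f x y (S i)

/-- The primal function `x ↦ max_{y ∈ Y} G(x, y)`. -/
noncomputable def primal (G : E → E' → ℝ) (Y : Set E') (x : E) : ℝ :=
  sSup ((fun y => G x y) '' Y)

/-- `(x₀, y₀)` solves `min_{x ∈ X} max_{y ∈ Y} G(x, y)`. -/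
structure IsMinimaxSolution (G : E → E' → ℝ) (X : Set E) (Y : Set E') (x₀ : E) (y₀ : E') :
    Prop where
  mem_left : x₀ ∈ X
  mem_right : y₀ ∈ Y
  isMinOn : ∀ x ∈ X, primal G Y x₀ ≤ primal G Y x
  isMaxOn : ∀ y ∈ Y, G x₀ y ≤ G x₀ y₀

/-- The nonconvex-strongly-concave setting on compact convex sets `X` and `Y`: for every `z`,
`(gx, gy)` is the gradient of `f(·, ·; z)` on `X × Y`, `f(x, ·; z)` is `μ`-strongly concave, and
`f(·, ·; z)` is `β`-smooth. (As the partial gradients are jointly Lipschitz on the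
convex set `X × Y`, `f(·, ·; z)` is then jointly continuously differentiable there.) -/
structure NCSC (X : Set E) (Y : Set E') (f : E → E' → Z → ℝ)
    (gx : E → E' → Z → E) (gy : E → E' → Z → E') (μ β : ℝ) : Prop where
  isCompact_left : IsCompact X
  convex_left : Convex ℝ X
  isCompact_right : IsCompact Y
  convex_right : Convex ℝ Y
  hasGrad_left : ∀ x ∈ X, ∀ y ∈ Y, ∀ z, HasGradOn (fun x' => f x' y z) X (gx x y z) x
  hasGrad_right : ∀ x ∈ X, ∀ y ∈ Y, ∀ z, HasGradOn (fun y' => f x y' z) Y (gy x y z) y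
  pos_concave : 0 < μ
  strongly_concave : ∀ x ∈ X, ∀ y₁ ∈ Y, ∀ y₂ ∈ Y, ∀ z,
    (-f x y₁ z) - (-f x y₂ z) ≥ inner ℝ (-gy x y₂ z) (y₁ - y₂) + μ / 2 * ‖y₁ - y₂‖ ^ 2
  pos_smooth : 0 < β
  smooth : ∀ x₁ ∈ X, ∀ x₂ ∈ X, ∀ y₁ ∈ Y, ∀ y₂ ∈ Y, ∀ z,
    √(‖gx x₁ y₁ z - gx x₂ y₂ z‖ ^ 2 + ‖gy x₁ y₁ z - gy x₂ y₂ z‖ ^ 2)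
      ≤ β * √(‖x₁ - x₂‖ ^ 2 + ‖y₁ - y₂‖ ^ 2)

/-- The Bernstein moment condition with parameter `B` for a random vector `v`; all the moments are
required to be finite. -/
structure Bernstein [MeasurableSpace Z] (P : Measure Z) (v : Z → E) (B : ℝ) : Prop where
  pos : 0 < B
  integrable : ∀ k : ℕ, 2 ≤ k → Integrable (fun z => ‖v z‖ ^ k) P
  moment_le : ∀ k : ℕ, 2 ≤ k →
    ∫ z, ‖v z‖ ^ k ∂P ≤ (k.factorial : ℝ) / 2 * (∫ z, ‖v z‖ ^ 2 ∂P) * B ^ (k - 2)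

end Problem

end Minimax

/-! Let `y*(x)` be the maximizer of `F(x, ·)` and `y_S(x)` that of `F_S(x, ·)`. By Danskin's theorem
the gradients of the primal functions are `∇ₓF(x, y*(x))` and `∇ₓF_S(x, y_S(x))`. Strong concavity
of `F_S` bounds `μ‖y*(x) - y_S(x)‖` by the error of the `y`-gradient at `y*(x)`. So the difference
of the two gradients is at most the error of the `x`-gradient plus `β/μ` times the error of the
`y`-gradient, both taken at `(x, y*(x))` (`SmoothConcave.norm_grad_sub_le`).

The point `(x, y*(x))` does not depend on the sample, and `y*` is `β/μ`-Lipschitz. Hence `x ↦ ∇f(x,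
y*(x); z)` is a family with Lipschitz constant `β(1 + β/μ)`, indexed by `X` alone, and only the
dimension `d` enters. Its error at `x` is split into the error at `x*` and an increment.

At `x*`, Bernstein's inequality in Hilbert space applies (`measure_pi_norm_sum_gt_le`). It comes
from bounding the expectation of the cosh of the norm of the partial sums, which grows by at most a
constant factor with each summand.

The increments over a ball of radius `r` are bounded by chaining along dyadic nets
(`measure_pi_exists_deviation_gt_le`). A union bound over the radii `2 ^ j / n` then turns `r` into
`max ‖x - x*‖ (1/n)`, at the price of a logarithm of the number of radii
(`measure_pi_exists_deviation_gt_max_le`). -/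

namespace Minimax

/-! ### Bernstein's inequality for sums of independent vectors in a Hilbert space. -/

section Bernstein

/-- The power series of `cosh √u` in `u` has nonnegative coefficients. -/
theorem convexOn_cosh_sqrt : ConvexOn ℝ (Set.Ici 0) (fun u : ℝ => Real.cosh √u) := by
  refine ⟨convex_Ici 0, ?_⟩
  intro u hu w hw a b ha hb hab
  have hs : ∀ t : ℝ, 0 ≤ t →
      HasSum (fun n : ℕ => t ^ n / (2 * n).factorial) (Real.cosh √t) := by
    intro t ht
    have := Real.hasSum_cosh √t
    simpa only [pow_mul, Real.sq_sqrt ht] using this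
  have hu' : (0 : ℝ) ≤ u := hu
  have hw' : (0 : ℝ) ≤ w := hw
  have hc : 0 ≤ a • u + b • w := by simp only [smul_eq_mul]; positivity
  refine hasSum_le (fun n => ?_) (hs _ hc) (((hs u hu').mul_left a).add ((hs w hw').mul_left b))
  have h1 := (convexOn_pow (𝕜 := ℝ) n).2 hu hw ha hb hab
  simp only [smul_eq_mul] at h1 ⊢
  rw [mul_div_assoc', mul_div_assoc', ← add_div]
  gcongr

theorem cosh_mul_add_sinh_mul_le (p m v : ℝ) :
    Real.cosh p * (1 + v) + Real.sinh p * m ≤ Real.exp v * Real.cosh (p + m) := by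
  have h1 : 1 + v + m ≤ Real.exp (v + m) := by linarith [Real.add_one_le_exp (v + m)]
  have h2 : 1 + v - m ≤ Real.exp (v - m) := by linarith [Real.add_one_le_exp (v - m)]
  have e1 : Real.exp v * Real.exp (p + m) = Real.exp p * Real.exp (v + m) := by
    rw [← Real.exp_add, ← Real.exp_add]; ring_nf
  have e2 : Real.exp v * Real.exp (-(p + m)) = Real.exp (-p) * Real.exp (v - m) := by
    rw [← Real.exp_add, ← Real.exp_add]; ring_nf
  have h3 := mul_le_mul_of_nonneg_left h1 (Real.exp_pos p).le
  have h4 := mul_le_mul_of_nonneg_left h2 (Real.exp_pos (-p)).le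
  rw [Real.cosh_eq, Real.cosh_eq, Real.sinh_eq]
  linarith

variable {H : Type*} [NormedAddCommGroup H] [InnerProductSpace ℝ H]

/-- `‖q + w‖ ^ 2` is a convex combination of `(‖q‖ + ‖w‖) ^ 2` and `(‖q‖ - ‖w‖) ^ 2`, with weights
given by the cosine of the angle, so convexity of `cosh √u` reduces the claim to addition formulas.
The term linear in `w` is kept exact, so that it can be integrated. -/
theorem cosh_norm_add_le (q w : H) :
    Real.cosh ‖q + w‖ ≤ Real.cosh ‖q‖ + Real.sinh ‖q‖ / ‖q‖ * inner ℝ q w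
      + Real.cosh ‖q‖ * (Real.exp ‖w‖ - 1 - ‖w‖) := by
  have hexp : Real.exp ‖w‖ = Real.cosh ‖w‖ + Real.sinh ‖w‖ := (Real.cosh_add_sinh _).symm
  have hr : ‖w‖ ≤ Real.sinh ‖w‖ := Real.self_le_sinh_iff.2 (norm_nonneg w)
  rcases eq_or_ne q 0 with rfl | hq
  · simp only [zero_add, norm_zero, Real.cosh_zero, inner_zero_left]
    linarith
  rcases eq_or_ne w 0 with rfl | hw
  · simp
  have ha : 0 < ‖q‖ := norm_pos_iff.2 hq
  have hr0 : 0 < ‖w‖ := norm_pos_iff.2 hw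
  set a := ‖q‖ with ha_def
  set r := ‖w‖ with hr_def
  set c := inner ℝ q w / (a * r) with hc_def
  have hin : inner ℝ q w = a * r * c := by rw [hc_def]; field_simp
  have habs : |inner ℝ q w| ≤ a * r := abs_real_inner_le_norm q w
  have hc : |c| ≤ 1 := by
    rw [hc_def, abs_div, abs_of_pos (mul_pos ha hr0), div_le_one (mul_pos ha hr0)]
    exact habs
  obtain ⟨hc1, hc2⟩ := abs_le.1 hc
  have hsq : ‖q + w‖ ^ 2 = (1 + c) / 2 * (a + r) ^ 2 + (1 - c) / 2 * (a - r) ^ 2 := by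
    rw [norm_add_sq_real, hin]; ring
  have hconv := convexOn_cosh_sqrt.2 (sq_nonneg (a + r)) (sq_nonneg (a - r))
    (show 0 ≤ (1 + c) / 2 by linarith) (show 0 ≤ (1 - c) / 2 by linarith) (by ring)
  simp only [smul_eq_mul] at hconv
  rw [← hsq, Real.sqrt_sq (norm_nonneg _), Real.sqrt_sq_eq_abs, Real.sqrt_sq_eq_abs,
    Real.cosh_abs, Real.cosh_abs, Real.cosh_add, Real.cosh_sub] at hconv
  have hsc : Real.sinh a ≤ Real.cosh a := by
    rw [Real.sinh_eq, Real.cosh_eq]; linarith [Real.exp_pos (-a)]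
  have hs0 : 0 ≤ Real.sinh a := Real.sinh_nonneg_iff.2 ha.le
  have hmul : Real.sinh a / a * inner ℝ q w = Real.sinh a * r * c := by rw [hin]; field_simp
  have key : Real.sinh a * (Real.sinh r - r) * c ≤ Real.cosh a * (Real.sinh r - r) := by
    have h1 : Real.sinh a * (Real.sinh r - r) * c ≤ Real.sinh a * (Real.sinh r - r) * 1 :=
      mul_le_mul_of_nonneg_left hc2 (mul_nonneg hs0 (by linarith))
    have h2 := mul_le_mul_of_nonneg_right hsc (show 0 ≤ Real.sinh r - r by linarith)
    linarith
  rw [hmul, hexp]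
  linarith

variable {Z : Type*} [MeasurableSpace Z] {P : Measure Z}

/-- Tonelli applied to the exponential series: the moment bounds cancel the factorials and leave a
geometric series. Working with `lintegral` yields integrability at the same time. -/
theorem exp_sub_integrable_and_integral_le {r : Z → ℝ} {V B l : ℝ} (hr : AEStronglyMeasurable r P)
    (hr0 : ∀ z, 0 ≤ r z) (hV : 0 ≤ V) (hB : 0 ≤ B)
    (hint : ∀ k : ℕ, 2 ≤ k → Integrable (fun z => r z ^ k) P)
    (hmom : ∀ k : ℕ, 2 ≤ k → ∫ z, r z ^ k ∂P ≤ (k.factorial : ℝ) / 2 * V * B ^ (k - 2))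
    (hl : 0 ≤ l) (hlB : l * B < 1) :
    Integrable (fun z => Real.exp (l * r z) - 1 - l * r z) P ∧
      ∫ z, (Real.exp (l * r z) - 1 - l * r z) ∂P ≤ l ^ 2 * V / (2 * (1 - l * B)) := by
  have hser : ∀ z, HasSum (fun k : ℕ => (l * r z) ^ (k + 2) / (k + 2).factorial)
      (Real.exp (l * r z) - 1 - l * r z) := by
    intro z
    have h := NormedSpace.expSeries_div_hasSum_exp (𝔸 := ℝ) (l * r z)
    rw [← Real.exp_eq_exp_ℝ] at h
    have h2 := (hasSum_nat_add_iff' 2).2 h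
    simpa [Finset.sum_range_succ, sub_sub] using h2
  have hnn : ∀ z, 0 ≤ Real.exp (l * r z) - 1 - l * r z := fun z => by
    linarith [Real.add_one_le_exp (l * r z)]
  have hae : AEStronglyMeasurable (fun z => Real.exp (l * r z) - 1 - l * r z) P :=
    ((Real.continuous_exp.comp_aestronglyMeasurable (hr.const_mul l)).sub
      aestronglyMeasurable_const).sub (hr.const_mul l)
  have hgeo : HasSum (fun k : ℕ => l ^ 2 * V / 2 * (l * B) ^ k) (l ^ 2 * V / (2 * (1 - l * B))) := by
    have := (hasSum_geometric_of_lt_one (mul_nonneg hl hB) hlB).mul_left (l ^ 2 * V / 2)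
    rwa [← div_eq_mul_inv, div_div] at this
  have hlint : ∫⁻ z, ENNReal.ofReal (Real.exp (l * r z) - 1 - l * r z) ∂P
      ≤ ENNReal.ofReal (l ^ 2 * V / (2 * (1 - l * B))) := by
    calc _ = ∫⁻ z, ∑' k : ℕ, ENNReal.ofReal ((l * r z) ^ (k + 2) / (k + 2).factorial) ∂P := by
          refine lintegral_congr fun z => ?_
          rw [← (hser z).tsum_eq, ENNReal.ofReal_tsum_of_nonneg _ (hser z).summable]
          intro k
          have := hr0 z
          positivity
      _ = ∑' k : ℕ, ∫⁻ z, ENNReal.ofReal ((l * r z) ^ (k + 2) / (k + 2).factorial) ∂P := by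
          refine lintegral_tsum fun k => ?_
          exact (((hr.const_mul l).pow _).aemeasurable.div_const _).ennreal_ofReal
      _ ≤ ∑' k : ℕ, ENNReal.ofReal (l ^ 2 * V / 2 * (l * B) ^ k) := by
          refine ENNReal.tsum_le_tsum fun k => ?_
          have e : (fun z => (l * r z) ^ (k + 2) / ((k + 2).factorial : ℝ))
              = fun z => l ^ (k + 2) / ((k + 2).factorial : ℝ) * r z ^ (k + 2) := by
            funext z; rw [mul_pow]; ring
          have hi : Integrable (fun z => (l * r z) ^ (k + 2) / ((k + 2).factorial : ℝ)) P := by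
            rw [e]; exact (hint (k + 2) (by omega)).const_mul _
          rw [← ofReal_integral_eq_lintegral_ofReal hi (Filter.Eventually.of_forall fun z => by
            have := hr0 z
            show 0 ≤ _
            positivity)]
          apply ENNReal.ofReal_le_ofReal
          rw [e, integral_const_mul]
          have hf : (0 : ℝ) < (k + 2).factorial := by exact_mod_cast Nat.factorial_pos _
          calc l ^ (k + 2) / ((k + 2).factorial : ℝ) * ∫ z, r z ^ (k + 2) ∂P
              ≤ l ^ (k + 2) / ((k + 2).factorial : ℝ)
                * (((k + 2).factorial : ℝ) / 2 * V * B ^ (k + 2 - 2)) := by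
                gcongr
                exact hmom (k + 2) (by omega)
            _ = l ^ 2 * V / 2 * (l * B) ^ k := by
                rw [Nat.add_sub_cancel, mul_pow, pow_add]; field_simp
      _ = ENNReal.ofReal (l ^ 2 * V / (2 * (1 - l * B))) := by
          rw [← ENNReal.ofReal_tsum_of_nonneg _ hgeo.summable, hgeo.tsum_eq]
          intro k; positivity
  have hI : Integrable (fun z => Real.exp (l * r z) - 1 - l * r z) P := by
    refine ⟨hae, ?_⟩
    rw [hasFiniteIntegral_iff_ofReal (Filter.Eventually.of_forall hnn)]
    exact hlint.trans_lt ENNReal.ofReal_lt_top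
  refine ⟨hI, ?_⟩
  rw [← ofReal_integral_eq_lintegral_ofReal hI (Filter.Eventually.of_forall hnn)] at hlint
  refine (ENNReal.ofReal_le_ofReal_iff ?_).1 hlint
  have : 0 < 1 - l * B := by linarith
  positivity

variable [CompleteSpace H] [IsProbabilityMeasure P]

/-- The mean is moved into the base point, `q = p - m`, and the expansion is made in the uncentred
vector. The linear term then contributes `⟪q, m⟫`, which `cosh_mul_add_sinh_mul_le` absorbs: `‖q‖ +
⟪q, m⟫ / ‖q‖ = ⟪q, p⟫ / ‖q‖ ≤ ‖p‖`. Thus centring costs nothing in the constants. -/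
theorem lintegral_cosh_norm_add_sub_le {ξ : Z → H} {v : ℝ} (hξ : Integrable ξ P)
    (hexp : Integrable (fun z => Real.exp ‖ξ z‖ - 1 - ‖ξ z‖) P)
    (hv : ∫ z, (Real.exp ‖ξ z‖ - 1 - ‖ξ z‖) ∂P ≤ v) (p : H) :
    ∫⁻ z, ENNReal.ofReal (Real.cosh ‖p + (ξ z - ∫ z, ξ z ∂P)‖) ∂P
      ≤ ENNReal.ofReal (Real.exp v) * ENNReal.ofReal (Real.cosh ‖p‖) := by
  set m := ∫ z, ξ z ∂P with hm
  set q := p - m with hq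
  set s := Real.sinh ‖q‖ / ‖q‖ with hs
  have hint : Integrable (fun z => Real.cosh ‖q‖ + s * inner ℝ q (ξ z)
      + Real.cosh ‖q‖ * (Real.exp ‖ξ z‖ - 1 - ‖ξ z‖)) P :=
    ((integrable_const _).add ((hξ.const_inner q).const_mul s)).add (hexp.const_mul _)
  have hle : ∀ z, Real.cosh ‖p + (ξ z - m)‖ ≤ Real.cosh ‖q‖ + s * inner ℝ q (ξ z)
      + Real.cosh ‖q‖ * (Real.exp ‖ξ z‖ - 1 - ‖ξ z‖) := by
    intro z
    have := cosh_norm_add_le q (ξ z)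
    rwa [show q + ξ z = p + (ξ z - m) by rw [hq]; abel] at this
  calc ∫⁻ z, ENNReal.ofReal (Real.cosh ‖p + (ξ z - m)‖) ∂P
      ≤ ∫⁻ z, ENNReal.ofReal (Real.cosh ‖q‖ + s * inner ℝ q (ξ z)
          + Real.cosh ‖q‖ * (Real.exp ‖ξ z‖ - 1 - ‖ξ z‖)) ∂P :=
        lintegral_mono fun z => ENNReal.ofReal_le_ofReal (hle z)
    _ = ENNReal.ofReal (∫ z, (Real.cosh ‖q‖ + s * inner ℝ q (ξ z)
          + Real.cosh ‖q‖ * (Real.exp ‖ξ z‖ - 1 - ‖ξ z‖)) ∂P) := by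
        refine (ofReal_integral_eq_lintegral_ofReal hint (Filter.Eventually.of_forall fun z => ?_)).symm
        exact (Real.cosh_pos _).le.trans (hle z)
    _ ≤ ENNReal.ofReal (Real.exp v * Real.cosh ‖p‖) := by
        apply ENNReal.ofReal_le_ofReal
        have hI : Integrable (fun z => Real.cosh ‖q‖ + s * inner ℝ q (ξ z)) P :=
          (integrable_const _).add ((hξ.const_inner q).const_mul s)
        rw [integral_add hI (hexp.const_mul _),
          integral_add (integrable_const _) ((hξ.const_inner q).const_mul s),
          integral_const_mul, integral_const_mul, integral_inner hξ, ← hm]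
        simp only [integral_const, probReal_univ, smul_eq_mul, one_mul]
        have h1 := mul_le_mul_of_nonneg_left hv (Real.cosh_pos ‖q‖).le
        have h2 := cosh_mul_add_sinh_mul_le ‖q‖ (inner ℝ q m / ‖q‖) v
        have h3 : Real.cosh (‖q‖ + inner ℝ q m / ‖q‖) ≤ Real.cosh ‖p‖ := by
          rw [Real.cosh_le_cosh, abs_norm]
          rcases eq_or_ne q 0 with h0 | h0
          · simp [h0]
          have hpos : 0 < ‖q‖ := norm_pos_iff.2 h0
          have e : ‖q‖ + inner ℝ q m / ‖q‖ = inner ℝ q p / ‖q‖ := by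
            have : p = q + m := by rw [hq]; abel
            rw [this, inner_add_right, real_inner_self_eq_norm_sq]
            field_simp
          rw [e, abs_div, abs_norm, div_le_iff₀ hpos, mul_comm]
          exact abs_real_inner_le_norm q p
        have h4 := mul_le_mul_of_nonneg_left h3 (Real.exp_pos v).le
        have h5 : s * inner ℝ q m = Real.sinh ‖q‖ * (inner ℝ q m / ‖q‖) := by rw [hs]; ring
        rw [h5]
        linarith
    _ = _ := ENNReal.ofReal_mul (Real.exp_pos v).le

theorem lintegral_pi_cosh_norm_sum_le {ξ : Z → H} {v : ℝ} (hm : StronglyMeasurable ξ)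
    (hξ : Integrable ξ P) (hexp : Integrable (fun z => Real.exp ‖ξ z‖ - 1 - ‖ξ z‖) P)
    (hv : ∫ z, (Real.exp ‖ξ z‖ - 1 - ‖ξ z‖) ∂P ≤ v) (n : ℕ) (p : H) :
    ∫⁻ S, ENNReal.ofReal (Real.cosh ‖p + ∑ i, (ξ (S i) - ∫ z, ξ z ∂P)‖)
        ∂(Measure.pi fun _ : Fin n => P)
      ≤ ENNReal.ofReal (Real.exp v) ^ n * ENNReal.ofReal (Real.cosh ‖p‖) := by
  -- The first summand is absorbed into the base point, so `p` has to vary.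
  induction n generalizing p with
  | zero => simp
  | succ n ih =>
    set m := ∫ z, ξ z ∂P
    have hmeas : ∀ (k : ℕ) (p : H), Measurable fun S : Fin k → Z =>
        ENNReal.ofReal (Real.cosh ‖p + ∑ i, (ξ (S i) - m)‖) := by
      intro k p
      have : StronglyMeasurable fun S : Fin k → Z => p + ∑ i, (ξ (S i) - m) := by
        refine stronglyMeasurable_const.add (Finset.stronglyMeasurable_fun_sum _ fun i _ => ?_)
        exact (hm.comp_measurable (measurable_pi_apply i)).sub stronglyMeasurable_const
      exact (Real.continuous_cosh.measurable.comp this.norm.measurable).ennreal_ofReal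
    have hmp := (measurePreserving_piFinSuccAbove (fun _ : Fin (n + 1) => P) 0).symm
    rw [← hmp.lintegral_comp (hmeas _ _)]
    refine (lintegral_prod _ ((hmeas _ _).comp hmp.measurable).aemeasurable).trans_le ?_
    calc _ = ∫⁻ z, ∫⁻ S, ENNReal.ofReal (Real.cosh ‖(p + (ξ z - m)) + ∑ i, (ξ (S i) - m)‖)
          ∂(Measure.pi fun _ : Fin n => P) ∂P := by
          refine lintegral_congr fun z => lintegral_congr fun S => ?_
          simp [MeasurableEquiv.piFinSuccAbove, Fin.sum_univ_succ, add_assoc, -Finset.sum_sub_distrib]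
      _ ≤ ∫⁻ z, ENNReal.ofReal (Real.exp v) ^ n
            * ENNReal.ofReal (Real.cosh ‖p + (ξ z - m)‖) ∂P :=
          lintegral_mono fun z => ih _
      _ = ENNReal.ofReal (Real.exp v) ^ n
            * ∫⁻ z, ENNReal.ofReal (Real.cosh ‖p + (ξ z - m)‖) ∂P :=
          lintegral_const_mul' _ _ (by simp)
      _ ≤ ENNReal.ofReal (Real.exp v) ^ n
            * (ENNReal.ofReal (Real.exp v) * ENNReal.ofReal (Real.cosh ‖p‖)) := by
          gcongr
          exact lintegral_cosh_norm_add_sub_le hξ hexp hv p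
      _ = _ := by rw [pow_succ, mul_assoc]

/-- A Chernoff bound for sums of independent Hilbert-space valued random vectors. -/
theorem measure_pi_norm_sum_gt_le_exp {ξ : Z → H} {V B l t : ℝ} (hm : AEStronglyMeasurable ξ P)
    (hV : 0 ≤ V) (hB : 0 ≤ B)
    (hint : ∀ k : ℕ, 2 ≤ k → Integrable (fun z => ‖ξ z‖ ^ k) P)
    (hmom : ∀ k : ℕ, 2 ≤ k → ∫ z, ‖ξ z‖ ^ k ∂P ≤ (k.factorial : ℝ) / 2 * V * B ^ (k - 2))
    (hl : 0 < l) (hlB : l * B < 1) (n : ℕ) :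
    Measure.pi (fun _ : Fin n => P) {S | t < ‖∑ i, (ξ (S i) - ∫ z, ξ z ∂P)‖}
      ≤ ENNReal.ofReal (2 * Real.exp (n * (l ^ 2 * V / (2 * (1 - l * B))) - l * t)) := by
  obtain ⟨η, hη, hηe⟩ := hm
  set v := l ^ 2 * V / (2 * (1 - l * B))
  have hξi : Integrable ξ P := by
    have h2 : MemLp ξ 2 P := (memLp_two_iff_integrable_sq_norm ⟨η, hη, hηe⟩).2 (hint 2 le_rfl)
    exact h2.integrable (by norm_num)
  have hηi : Integrable η P := hξi.congr hηe
  have hmean : ∫ z, ξ z ∂P = ∫ z, η z ∂P := integral_congr_ae hηe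
  have hpow : ∀ k : ℕ, (fun z => ‖ξ z‖ ^ k) =ᵐ[P] fun z => ‖η z‖ ^ k := fun k => by
    filter_upwards [hηe] with z hz
    rw [hz]
  obtain ⟨h1, h2⟩ := exp_sub_integrable_and_integral_le (r := fun z => ‖η z‖) (P := P)
    hη.norm.aestronglyMeasurable (fun z => norm_nonneg _) hV hB
    (fun k hk => (hint k hk).congr (hpow k))
    (fun k hk => by rw [← integral_congr_ae (hpow k)]; exact hmom k hk) hl.le hlB
  have hn : ∀ z, ‖l • η z‖ = l * ‖η z‖ := fun z => by rw [norm_smul, Real.norm_of_nonneg hl.le]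
  have hmgf := lintegral_pi_cosh_norm_sum_le (P := P) (ξ := fun z => l • η z) (v := v)
    (hη.const_smul l) (hηi.smul l) (by simpa only [hn] using h1) (by simpa only [hn] using h2) n 0
  simp only [zero_add, norm_zero, Real.cosh_zero, ENNReal.ofReal_one, mul_one] at hmgf
  set M := Measure.pi (fun _ : Fin n => P)
  -- `cosh a ≥ exp a / 2` is the source of the factor 2 in the tail bound.
  have hset : M {S | t < ‖∑ i, (ξ (S i) - ∫ z, ξ z ∂P)‖}
      ≤ M {S | ENNReal.ofReal (Real.exp (l * t) / 2)
        ≤ ENNReal.ofReal (Real.cosh ‖∑ i, (l • η (S i) - ∫ z, l • η z ∂P)‖)} := by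
    have hae : ∀ᵐ S ∂M, ∀ i, ξ (S i) = η (S i) := by
      rw [Filter.eventually_all]
      intro i
      exact (Measure.tendsto_eval_ae_ae (μ := fun _ : Fin n => P) (i := i)).eventually hηe
    refine measure_mono_ae ?_
    filter_upwards [hae] with S hS hlt
    apply ENNReal.ofReal_le_ofReal
    rw [integral_smul, ← hmean]
    have e : ∑ i, (l • η (S i) - l • ∫ z, ξ z ∂P) = l • ∑ i, (ξ (S i) - ∫ z, ξ z ∂P) := by
      rw [Finset.smul_sum]
      exact Finset.sum_congr rfl fun i _ => by rw [hS i, smul_sub]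
    rw [e, norm_smul, Real.norm_of_nonneg hl.le, Real.cosh_eq]
    have hlt' : t < ‖∑ i, (ξ (S i) - ∫ z, ξ z ∂P)‖ := hlt
    have := Real.exp_le_exp.2 (mul_le_mul_of_nonneg_left hlt'.le hl.le)
    have h0 := Real.exp_pos (-(l * ‖∑ i, (ξ (S i) - ∫ z, ξ z ∂P)‖))
    linarith
  have hmeas : AEMeasurable (fun S : Fin n → Z =>
      ENNReal.ofReal (Real.cosh ‖∑ i, (l • η (S i) - ∫ z, l • η z ∂P)‖)) M := by
    have : StronglyMeasurable fun S : Fin n → Z => ∑ i, (l • η (S i) - ∫ z, l • η z ∂P) := by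
      refine Finset.stronglyMeasurable_fun_sum _ fun i _ => ?_
      exact ((hη.const_smul l).comp_measurable (measurable_pi_apply i)).sub stronglyMeasurable_const
    exact (Real.continuous_cosh.measurable.comp this.norm.measurable).ennreal_ofReal.aemeasurable
  refine hset.trans ((meas_ge_le_lintegral_div hmeas (by simp; positivity) (by simp)).trans ?_)
  refine (ENNReal.div_le_div_right hmgf _).trans ?_
  rw [← ENNReal.ofReal_pow (Real.exp_pos v).le, ← ENNReal.ofReal_div_of_pos (by positivity),
    ← Real.exp_nat_mul, Real.exp_sub]
  apply le_of_eq
  congr 1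
  field_simp

/-- **Bernstein's inequality** in a Hilbert space, under moment conditions on the uncentred
vectors. -/
theorem measure_pi_norm_sum_gt_le {ξ : Z → H} {V B L : ℝ} (hm : AEStronglyMeasurable ξ P)
    (hV : 0 ≤ V) (hB : 0 < B)
    (hint : ∀ k : ℕ, 2 ≤ k → Integrable (fun z => ‖ξ z‖ ^ k) P)
    (hmom : ∀ k : ℕ, 2 ≤ k → ∫ z, ‖ξ z‖ ^ k ∂P ≤ (k.factorial : ℝ) / 2 * V * B ^ (k - 2))
    (hL : 0 < L) {n : ℕ} (hn : 0 < n) :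
    Measure.pi (fun _ : Fin n => P)
        {S | √(2 * (n * V) * L) + B * L < ‖∑ i, (ξ (S i) - ∫ z, ξ z ∂P)‖}
      ≤ ENNReal.ofReal (2 * Real.exp (-L)) := by
  have hn' : (0 : ℝ) < n := by exact_mod_cast hn
  rcases hV.eq_or_lt with rfl | hV
  -- With zero variance the exponent is linear in `l`, and its optimum `l = 1 / B` is only
  -- approached.
  · have hlim : Filter.Tendsto (fun l : ℝ => ENNReal.ofReal (2 * Real.exp (-(l * (B * L)))))
        (nhdsWithin B⁻¹ (Set.Iio B⁻¹)) (nhds (ENNReal.ofReal (2 * Real.exp (-L)))) := by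
      have hc : Continuous fun l : ℝ => ENNReal.ofReal (2 * Real.exp (-(l * (B * L)))) :=
        ENNReal.continuous_ofReal.comp (by fun_prop)
      have := hc.tendsto B⁻¹
      rw [show B⁻¹ * (B * L) = L by field_simp] at this
      exact this.mono_left nhdsWithin_le_nhds
    refine ge_of_tendsto hlim ?_
    filter_upwards [Ioo_mem_nhdsLT (inv_pos.2 hB)] with l hl
    have hlB : l * B < 1 := by
      have := mul_lt_mul_of_pos_right hl.2 hB
      rwa [inv_mul_cancel₀ hB.ne'] at this
    have := measure_pi_norm_sum_gt_le_exp (t := B * L) hm le_rfl hB.le hint hmom hl.1 hlB n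
    simpa using this
  -- The choice `l = s / (1 + s * B)` gives `1 - l * B = 1 / (1 + s * B)`. With `L = n * V * s ^ 2 /
  -- 2` the exponent is then exactly `-L`.
  · set s := √(2 * L / (n * V)) with hs
    have hs0 : 0 < s := Real.sqrt_pos.2 (by positivity)
    have hs2 : s ^ 2 = 2 * L / (n * V) := Real.sq_sqrt (by positivity)
    have hLs : L = n * V * s ^ 2 / 2 := by rw [hs2]; field_simp
    have ht : √(2 * (n * V) * L) = n * V * s := by
      rw [show 2 * (n * V) * L = (n * V * s) ^ 2 by rw [hLs]; ring]
      exact Real.sqrt_sq (by positivity)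
    have hlB : s / (1 + s * B) * B < 1 := by
      rw [div_mul_eq_mul_div, div_lt_one (by positivity)]; linarith
    have := measure_pi_norm_sum_gt_le_exp (t := √(2 * (n * V) * L) + B * L) hm hV.le hB.le hint hmom
      (show 0 < s / (1 + s * B) by positivity) hlB n
    convert this using 4
    have h1 : 1 - s / (1 + s * B) * B = 1 / (1 + s * B) := by field_simp; ring
    rw [h1, ht, hLs]
    field_simp
    ring

theorem measure_pi_norm_average_sub_gt_le {ξ : Z → H} {V B L : ℝ} (hm : AEStronglyMeasurable ξ P)
    (hV : 0 ≤ V) (hB : 0 < B)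
    (hint : ∀ k : ℕ, 2 ≤ k → Integrable (fun z => ‖ξ z‖ ^ k) P)
    (hmom : ∀ k : ℕ, 2 ≤ k → ∫ z, ‖ξ z‖ ^ k ∂P ≤ (k.factorial : ℝ) / 2 * V * B ^ (k - 2))
    (hL : 0 < L) {n : ℕ} (hn : 0 < n) :
    Measure.pi (fun _ : Fin n => P)
        {S | √(2 * V * L / n) + B * L / n < ‖(1 / (n : ℝ)) • ∑ i, ξ (S i) - ∫ z, ξ z ∂P‖}
      ≤ ENNReal.ofReal (2 * Real.exp (-L)) := by
  have hn' : (0 : ℝ) < n := by exact_mod_cast hn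
  refine (measure_mono fun S hS => ?_).trans (measure_pi_norm_sum_gt_le hm hV hB hint hmom hL hn)
  have hS' : √(2 * V * L / n) + B * L / n
      < ‖(1 / (n : ℝ)) • ∑ i, ξ (S i) - ∫ z, ξ z ∂P‖ := hS
  have e : (1 / (n : ℝ)) • ∑ i, ξ (S i) - ∫ z, ξ z ∂P
      = (1 / (n : ℝ)) • ∑ i, (ξ (S i) - ∫ z, ξ z ∂P) := by
    rw [Finset.sum_sub_distrib, smul_sub, Finset.sum_const, Finset.card_univ, Fintype.card_fin,
      ← Nat.cast_smul_eq_nsmul ℝ, smul_smul, one_div, inv_mul_cancel₀ hn'.ne', one_smul]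
  rw [e, norm_smul, Real.norm_of_nonneg (by positivity)] at hS'
  have h1 : √(2 * (n * V) * L) = n * √(2 * V * L / n) := by
    rw [show 2 * (n * V) * L = n ^ 2 * (2 * V * L / n) by field_simp,
      Real.sqrt_mul (by positivity), Real.sqrt_sq hn'.le]
  have h2 := mul_lt_mul_of_pos_left hS' hn'
  rw [Set.mem_ofPred_eq, h1]
  calc _ = n * (√(2 * V * L / n) + B * L / n) := by field_simp
    _ < _ := h2
    _ = _ := by field_simp

end Bernstein

/-! ### Uniform control of increments: dyadic nets, chaining and peeling. -/

section Chaining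

variable {E : Type*} [NormedAddCommGroup E] [NormedSpace ℝ E] [FiniteDimensional ℝ E]

/-- Rescaling by `2 / r` gives the normalization of `Besicovitch.card_le_of_separated`: radius 2 and
separation 1. -/
theorem card_le_of_separated_of_dist_le {t : Finset E} {p : E} {r : ℝ} (hr : 0 < r)
    (ht : ∀ c ∈ t, ‖c - p‖ ≤ r) (hsep : ∀ c ∈ t, ∀ c' ∈ t, c ≠ c' → r / 2 ≤ ‖c - c'‖) :
    t.card ≤ 5 ^ Module.finrank ℝ E := by
  classical
  have hinj : Function.Injective fun c : E => (2 / r) • (c - p) := by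
    intro c c' h
    have h2 := smul_right_injective E (show (2 / r) ≠ 0 by positivity) h
    exact sub_left_injective h2
  rw [← Finset.card_image_of_injective t hinj]
  have h2r : ‖2 / r‖ = 2 / r := Real.norm_of_nonneg (by positivity)
  refine Besicovitch.card_le_of_separated _ ?_ ?_
  · intro c hc
    obtain ⟨c, hct, rfl⟩ := Finset.mem_image.1 hc
    rw [norm_smul, h2r, div_mul_eq_mul_div, div_le_iff₀ hr]
    have := ht c hct
    linarith
  · intro c hc c' hc' hne
    obtain ⟨c, hct, rfl⟩ := Finset.mem_image.1 hc
    obtain ⟨c', hct', rfl⟩ := Finset.mem_image.1 hc'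
    rw [← smul_sub, sub_sub_sub_cancel_right, norm_smul, h2r, div_mul_eq_mul_div, le_div_iff₀ hr]
    have := hsep c hct c' hct' (fun h => hne (by rw [h]))
    linarith

/-- A separated set of maximal cardinality is a net; the packing bound ensures that a maximum
exists. The net lies in `X`, where the Lipschitz bounds are available. -/
theorem exists_finset_cover_half (X : Set E) (p : E) {r : ℝ} (hr : 0 < r) :
    ∃ t : Finset E, (∀ q ∈ t, q ∈ X ∧ ‖q - p‖ ≤ r) ∧ t.card ≤ 5 ^ Module.finrank ℝ E ∧
      ∀ x ∈ X, ‖x - p‖ ≤ r → ∃ q ∈ t, ‖x - q‖ ≤ r / 2 := by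
  classical
  let good : Finset E → Prop := fun t => (∀ q ∈ t, q ∈ X ∧ ‖q - p‖ ≤ r) ∧
    ∀ c ∈ t, ∀ c' ∈ t, c ≠ c' → r / 2 ≤ ‖c - c'‖
  have hbd : ∀ t, good t → t.card ≤ 5 ^ Module.finrank ℝ E := fun t ht =>
    card_le_of_separated_of_dist_le hr (fun c hc => (ht.1 c hc).2) ht.2
  let N : Set ℕ := {m | ∃ t, good t ∧ t.card = m}
  have hN : N.Nonempty := ⟨0, ∅, by simp [good], rfl⟩
  have hNb : BddAbove N := ⟨5 ^ Module.finrank ℝ E, by rintro m ⟨t, ht, rfl⟩; exact hbd t ht⟩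
  obtain ⟨t, ht, htc⟩ := Nat.sSup_mem hN hNb
  refine ⟨t, ht.1, hbd t ht, ?_⟩
  intro x hx hxp
  by_contra! hcon
  have hxt : x ∉ t := fun h => by
    have := hcon x h
    rw [sub_self, norm_zero] at this
    linarith
  have hgood : good (insert x t) := by
    refine ⟨?_, ?_⟩
    · intro q hq
      rcases Finset.mem_insert.1 hq with rfl | hq
      · exact ⟨hx, hxp⟩
      · exact ht.1 q hq
    · intro c hc c' hc' hne
      rcases Finset.mem_insert.1 hc with rfl | hct <;> rcases Finset.mem_insert.1 hc' with rfl | hct'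
      · exact absurd rfl hne
      · exact (hcon c' hct').le
      · rw [norm_sub_rev]; exact (hcon c hct).le
      · exact ht.2 c hct c' hct' hne
  have := le_csSup hNb (show (insert x t).card ∈ N from ⟨_, hgood, rfl⟩)
  rw [Finset.card_insert_of_notMem hxt, ← htc] at this
  omega

/-- A tree of nets of dyadic resolution: finitely many links at each level, such that every point
of `X` near `x₀` is the limit of a path of links starting from `x₀`. -/
theorem exists_chaining_links (X : Set E) {x₀ : E} (hx₀ : x₀ ∈ X) {r : ℝ} (hr : 0 < r) :
    ∃ links : ℕ → Finset (E × E),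
      (∀ k, (links k).card ≤ (5 ^ Module.finrank ℝ E) ^ (k + 1)) ∧
      (∀ k, ∀ l ∈ links k, l.1 ∈ X ∧ l.2 ∈ X ∧ ‖l.2 - l.1‖ ≤ r / 2 ^ k) ∧
      ∀ x ∈ X, ‖x - x₀‖ ≤ r → ∃ c : ℕ → E, c 0 = x₀ ∧
        ∀ k, (c k, c (k + 1)) ∈ links k ∧ ‖x - c k‖ ≤ r / 2 ^ k := by
  classical
  have hrk : ∀ k : ℕ, 0 < r / 2 ^ k := fun k => by positivity
  choose half hmem hcard hcov using fun (p : E) (k : ℕ) => exists_finset_cover_half X p (hrk k)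
  let net : ℕ → Finset E := fun k =>
    Nat.rec {x₀} (fun k s => s.biUnion fun p => half p k) k
  let links : ℕ → Finset (E × E) := fun k =>
    (net k).biUnion fun p => (half p k).image fun q => (p, q)
  have hnet : ∀ k, net (k + 1) = (net k).biUnion fun p => half p k := fun k => rfl
  have hnetX : ∀ k, ∀ p ∈ net k, p ∈ X := by
    intro k
    cases k with
    | zero =>
      intro p hp
      rw [Finset.mem_singleton.1 hp]
      exact hx₀
    | succ k =>
      intro p hp
      rw [hnet, Finset.mem_biUnion] at hp
      obtain ⟨p', -, hp⟩ := hp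
      exact (hmem p' k p hp).1
  have hnetc : ∀ k, (net k).card ≤ (5 ^ Module.finrank ℝ E) ^ k := by
    intro k
    induction k with
    | zero => simp [net]
    | succ k ih =>
      rw [hnet, pow_succ]
      exact (Finset.card_biUnion_le_card_mul _ _ _ fun p _ => hcard p k).trans
        (Nat.mul_le_mul_right _ ih)
  refine ⟨links, ?_, ?_, ?_⟩
  · intro k
    rw [pow_succ]
    exact (Finset.card_biUnion_le_card_mul _ _ _
      fun p _ => Finset.card_image_le.trans (hcard p k)).trans (Nat.mul_le_mul_right _ (hnetc k))
  · intro k l hl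
    obtain ⟨p, hp, hl⟩ := Finset.mem_biUnion.1 hl
    obtain ⟨q, hq, rfl⟩ := Finset.mem_image.1 hl
    exact ⟨hnetX k p hp, hmem p k q hq⟩
  · intro x hx hxr
    -- The subtype carries the distance to `x` along the path, so that the recursion can select the
    -- next node.
    have hstep : ∀ k (p : {p // p ∈ net k ∧ ‖x - p‖ ≤ r / 2 ^ k}),
        ∃ q : {q // q ∈ net (k + 1) ∧ ‖x - q‖ ≤ r / 2 ^ (k + 1)},
          (p.1, q.1) ∈ links k := by
      rintro k ⟨p, hp, hxp⟩
      obtain ⟨q, hq, hxq⟩ := hcov p k x hx hxp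
      refine ⟨⟨q, ?_, ?_⟩, ?_⟩
      · rw [hnet, Finset.mem_biUnion]
        exact ⟨p, hp, hq⟩
      · rwa [pow_succ, ← div_div]
      · exact Finset.mem_biUnion.2 ⟨p, hp, Finset.mem_image.2 ⟨q, hq, rfl⟩⟩
    choose next hnext using hstep
    let c : ∀ k, {p // p ∈ net k ∧ ‖x - p‖ ≤ r / 2 ^ k} := fun k =>
      Nat.rec ⟨x₀, Finset.mem_singleton_self _, by simpa using hxr⟩ (fun k p => next k p) k
    exact ⟨fun k => (c k).1, rfl, fun k => ⟨hnext k (c k), (c k).2.2⟩⟩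

variable {H : Type*} [NormedAddCommGroup H] [InnerProductSpace ℝ H] [CompleteSpace H]
  {Z : Type*} [MeasurableSpace Z] {P : Measure Z} [IsProbabilityMeasure P]

/-- Bounded vectors satisfy the moment condition with `V = D ^ 2` and `B = D`, because `k! / 2 ≥ 1`
for `k ≥ 2`. -/
theorem measure_pi_norm_average_sub_gt_le_of_norm_le {ξ : Z → H} {D L : ℝ}
    (hm : AEStronglyMeasurable ξ P) (hD : 0 < D) (hξ : ∀ z, ‖ξ z‖ ≤ D) (hL : 0 < L)
    {n : ℕ} (hn : 0 < n) :
    Measure.pi (fun _ : Fin n => P)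
        {S | D * (√(2 * L / n) + L / n) < ‖(1 / (n : ℝ)) • ∑ i, ξ (S i) - ∫ z, ξ z ∂P‖}
      ≤ ENNReal.ofReal (2 * Real.exp (-L)) := by
  have hint : ∀ k : ℕ, Integrable (fun z => ‖ξ z‖ ^ k) P := fun k =>
    Integrable.of_bound (hm.norm.pow k) (D ^ k) (Filter.Eventually.of_forall fun z => by
      rw [norm_pow, norm_norm]
      exact pow_le_pow_left₀ (norm_nonneg _) (hξ z) k)
  have h := measure_pi_norm_average_sub_gt_le (V := D ^ 2) (B := D) hm (sq_nonneg D) hD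
    (fun k _ => hint k) (fun k hk => ?_) hL hn
  · convert h using 5 with S
    rw [show 2 * D ^ 2 * L / n = D ^ 2 * (2 * L / n) by ring, Real.sqrt_mul (sq_nonneg D),
      Real.sqrt_sq hD.le]
    ring
  · have h1 : ∫ z, ‖ξ z‖ ^ k ∂P ≤ ∫ _, D ^ k ∂P :=
      integral_mono (hint k) (integrable_const _) fun z =>
        pow_le_pow_left₀ (norm_nonneg _) (hξ z) k
    rw [integral_const, probReal_univ, one_smul] at h1
    have h2 : (2 : ℝ) ≤ k.factorial := by
      exact_mod_cast hk.trans (Nat.self_le_factorial k)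
    have h3 : D ^ k = D ^ 2 * D ^ (k - 2) := by rw [← pow_add]; congr 1; omega
    have h4 : 0 ≤ D ^ 2 * D ^ (k - 2) := by positivity
    rw [h3] at h1
    nlinarith

/-- The deviation of the average of `g x` over the sample `S` from its expectation. -/
noncomputable def deviation (P : Measure Z) {E : Type*} (g : E → Z → H) {n : ℕ} (S : Fin n → Z)
    (x : E) : H :=
  (1 / (n : ℝ)) • ∑ i, g x (S i) - ∫ z, g x z ∂P

omit [FiniteDimensional ℝ E] [NormedSpace ℝ E] [CompleteSpace H] in
-- A crude bound valid for every sample; it lets the chaining path pass to its limit.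
theorem norm_deviation_sub_le {X : Set E} {g : E → Z → H} {L : ℝ}
    (hg : ∀ x ∈ X, Integrable (g x) P)
    (hlip : ∀ x ∈ X, ∀ x' ∈ X, ∀ z, ‖g x z - g x' z‖ ≤ L * ‖x - x'‖) {n : ℕ} (hn : 0 < n)
    (S : Fin n → Z) {x x' : E} (hx : x ∈ X) (hx' : x' ∈ X) :
    ‖deviation P g S x - deviation P g S x'‖ ≤ 2 * L * ‖x - x'‖ := by
  have hn' : (0 : ℝ) < n := by exact_mod_cast hn
  have e : deviation P g S x - deviation P g S x'
      = (1 / (n : ℝ)) • ∑ i, (g x (S i) - g x' (S i)) - ∫ z, (g x z - g x' z) ∂P := by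
    rw [deviation, deviation, integral_sub (hg x hx) (hg x' hx'), Finset.sum_sub_distrib, smul_sub]
    abel
  have h1 : ‖(1 / (n : ℝ)) • ∑ i, (g x (S i) - g x' (S i))‖ ≤ L * ‖x - x'‖ := by
    rw [norm_smul, Real.norm_of_nonneg (by positivity), one_div, inv_mul_le_iff₀ hn']
    refine (norm_sum_le_of_le _ fun i _ => hlip x hx x' hx' (S i)).trans ?_
    simp
  have h2 : ‖∫ z, (g x z - g x' z) ∂P‖ ≤ L * ‖x - x'‖ := by
    have := norm_integral_le_of_norm_le_const (μ := P)
      (Filter.Eventually.of_forall (hlip x hx x' hx'))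
    simpa using this
  rw [e]
  exact (norm_sub_le _ _).trans (by linarith)

theorem sum_succ_div_two_pow_le (K : ℕ) : ∑ k ∈ Finset.range K, ((k : ℝ) + 1) / 2 ^ k ≤ 4 := by
  have h : ∀ K : ℕ, ∑ k ∈ Finset.range K, ((k : ℝ) + 1) / 2 ^ k = 4 - (2 * K + 4) / 2 ^ K := by
    intro K
    induction K with
    | zero => norm_num
    | succ K ih =>
      rw [Finset.sum_range_succ, ih]
      push_cast
      field_simp
      ring
  rw [h]
  have : (0 : ℝ) ≤ (2 * K + 4) / 2 ^ K := by positivity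
  linarith

/-- Local uniform concentration by chaining: the increments of the deviation process of a Lipschitz
family over a ball of radius `r`. -/
theorem measure_pi_exists_deviation_gt_le {X : Set E} {g : E → Z → H} {L r u : ℝ} (hL : 0 < L)
    (hg : ∀ x ∈ X, Integrable (g x) P)
    (hlip : ∀ x ∈ X, ∀ x' ∈ X, ∀ z, ‖g x z - g x' z‖ ≤ L * ‖x - x'‖) {n : ℕ} (hn : 0 < n)
    {x₀ : E} (hx₀ : x₀ ∈ X) (hr : 0 < r) (hu : (Module.finrank ℝ E : ℝ) ≤ u) (hu2 : 2 ≤ u) :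
    Measure.pi (fun _ : Fin n => P)
        {S | ∃ x ∈ X, ‖x - x₀‖ ≤ r ∧
          16 * L * r * (√(u / n) + u / n) < ‖deviation P g S x - deviation P g S x₀‖}
      ≤ ENNReal.ofReal (Real.exp (-u)) := by
  have hn' : (0 : ℝ) < n := by exact_mod_cast hn
  have hu0 : 0 < u := by linarith
  obtain ⟨links, hcard, hlinks, hchain⟩ := exists_chaining_links X hx₀ hr
  set M := Measure.pi (fun _ : Fin n => P)
  set W := √(u / n) + u / n with hW
  -- Level `k` is run at confidence `4 * (k + 1) * u`, to beat the `5 ^ (d * (k + 1))` links. The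
  -- thresholds remain summable against the lengths `r / 2 ^ k`: the sum of `(k + 1) / 2 ^ k` is at
  -- most 4, whence the constant 16.
  let bad : ℕ → E × E → Set (Fin n → Z) := fun k l =>
    {S | L * (r / 2 ^ k) * (4 * (k + 1) * W) < ‖deviation P g S l.2 - deviation P g S l.1‖}
  have hbad : ∀ k, ∀ l ∈ links k, M (bad k l) ≤ ENNReal.ofReal (2 * Real.exp (-(4 * (k + 1) * u))) := by
    intro k l hl
    obtain ⟨h1, h2, h3⟩ := hlinks k l hl
    have hD : 0 < L * (r / 2 ^ k) := by positivity
    have hb := measure_pi_norm_average_sub_gt_le_of_norm_le (P := P)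
      (ξ := fun z => g l.2 z - g l.1 z) (D := L * (r / 2 ^ k)) (L := 4 * (k + 1) * u)
      ((hg _ h2).sub (hg _ h1)).aestronglyMeasurable hD
      (fun z => (hlip _ h2 _ h1 z).trans (mul_le_mul_of_nonneg_left h3 hL.le)) (by positivity) hn
    refine (measure_mono fun S hS => ?_).trans hb
    have hS' : L * (r / 2 ^ k) * (4 * (k + 1) * W)
        < ‖deviation P g S l.2 - deviation P g S l.1‖ := hS
    have e : deviation P g S l.2 - deviation P g S l.1
        = (1 / (n : ℝ)) • ∑ i, (g l.2 (S i) - g l.1 (S i)) - ∫ z, (g l.2 z - g l.1 z) ∂P := by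
      rw [deviation, deviation, integral_sub (hg _ h2) (hg _ h1), Finset.sum_sub_distrib, smul_sub]
      abel
    rw [e] at hS'
    refine lt_of_le_of_lt (mul_le_mul_of_nonneg_left ?_ hD.le) hS'
    have hk : (1 : ℝ) ≤ k + 1 := by linarith [Nat.cast_nonneg (α := ℝ) k]
    have hsq : √(2 * (4 * (k + 1) * u) / n) ≤ 4 * (k + 1) * √(u / n) := by
      rw [show 2 * (4 * (k + 1) * u) / n = (8 * (k + 1)) * (u / n) by ring,
        Real.sqrt_mul (by positivity)]
      refine mul_le_mul_of_nonneg_right ?_ (Real.sqrt_nonneg _)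
      rw [Real.sqrt_le_left (by positivity)]
      nlinarith
    calc _ ≤ 4 * (k + 1) * √(u / n) + 4 * (k + 1) * u / n := by gcongr
      _ = _ := by rw [hW]; ring
  have hsub : {S | ∃ x ∈ X, ‖x - x₀‖ ≤ r ∧
      16 * L * r * W < ‖deviation P g S x - deviation P g S x₀‖}
      ⊆ ⋃ k, ⋃ l ∈ links k, bad k l := by
    rintro S ⟨x, hx, hxr, hlt⟩
    by_contra hcon
    simp only [Set.mem_iUnion, not_exists] at hcon
    obtain ⟨c, hc0, hc⟩ := hchain x hx hxr
    refine absurd hlt (not_lt.2 ?_)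
    have hstep : ∀ k, ‖deviation P g S (c (k + 1)) - deviation P g S (c k)‖
        ≤ L * (r / 2 ^ k) * (4 * (k + 1) * W) := fun k => not_lt.1 (hcon k _ (hc k).1)
    have hW0 : 0 ≤ W := by positivity
    have htele : ∀ K, ‖deviation P g S (c K) - deviation P g S x₀‖ ≤ 16 * L * r * W := by
      intro K
      have h1 := Finset.sum_range_sub (fun k => deviation P g S (c k)) K
      rw [hc0] at h1
      rw [← h1]
      refine (norm_sum_le_of_le _ fun k _ => hstep k).trans ?_
      have h2 := mul_le_mul_of_nonneg_left (sum_succ_div_two_pow_le K)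
        (show 0 ≤ 4 * L * r * W by positivity)
      rw [Finset.mul_sum] at h2
      refine le_trans (le_of_eq (Finset.sum_congr rfl fun k _ => ?_)) (h2.trans (le_of_eq ?_))
      · ring
      · ring
    have hlim : Filter.Tendsto (fun K : ℕ => 2 * L * (r * (1 / 2) ^ K) + 16 * L * r * W)
        Filter.atTop (nhds (2 * L * (r * 0) + 16 * L * r * W)) :=
      (((tendsto_pow_atTop_nhds_zero_of_lt_one (by norm_num) (by norm_num)).const_mul r).const_mul
        (2 * L)).add_const _
    rw [mul_zero, mul_zero, zero_add] at hlim
    refine ge_of_tendsto' hlim fun K => ?_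
    have h3 := norm_deviation_sub_le hg hlip hn S hx (hlinks K _ (hc K).1).1
    have h4 := mul_le_mul_of_nonneg_left (hc K).2 (show 0 ≤ 2 * L by positivity)
    have h5 := norm_sub_le_norm_sub_add_norm_sub (deviation P g S x) (deviation P g S (c K))
      (deviation P g S x₀)
    have h6 : r * (1 / 2) ^ K = r / 2 ^ K := by rw [one_div, inv_pow]; rfl
    rw [h6]
    linarith [htele K]
  have hlevel : ∀ k, M (⋃ l ∈ links k, bad k l)
      ≤ ENNReal.ofReal (Real.exp (-u) * (1 / 2) ^ (k + 1)) := by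
    intro k
    refine (measure_biUnion_finset_le _ _).trans ((Finset.sum_le_card_nsmul _ _ _ (hbad k)).trans ?_)
    rw [nsmul_eq_mul, ← ENNReal.ofReal_natCast, ← ENNReal.ofReal_mul (by positivity)]
    apply ENNReal.ofReal_le_ofReal
    -- As `d ≤ u`, the number of links is at most `exp (2 * (k + 1) * u)`, which uses up half of the
    -- exponent `4 * (k + 1) * u`.
    have h5 : (5 : ℝ) ≤ Real.exp 2 := by
      have := Real.exp_one_gt_d9
      rw [show (2 : ℝ) = 1 + 1 by norm_num, Real.exp_add]
      nlinarith
    have hc : ((links k).card : ℝ) ≤ Real.exp (2 * (k + 1) * u) := by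
      calc ((links k).card : ℝ) ≤ ((5 : ℝ) ^ Module.finrank ℝ E) ^ (k + 1) := by
            exact_mod_cast hcard k
        _ ≤ (Real.exp 2 ^ Module.finrank ℝ E) ^ (k + 1) := by gcongr
        _ = Real.exp (2 * (k + 1) * Module.finrank ℝ E) := by
            rw [← Real.exp_nat_mul, ← Real.exp_nat_mul]
            congr 1
            push_cast
            ring
        _ ≤ _ := by gcongr
    have h4 : Real.exp (-u) ≤ 1 / 4 := by
      rw [Real.exp_neg, one_div]
      apply inv_anti₀ (by norm_num)
      have := Real.exp_le_exp.2 hu2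
      linarith
    calc ((links k).card : ℝ) * (2 * Real.exp (-(4 * (k + 1) * u)))
        ≤ Real.exp (2 * (k + 1) * u) * (2 * Real.exp (-(4 * (k + 1) * u))) := by gcongr
      _ = 2 * Real.exp (-(2 * (k + 1) * u)) := by
          rw [mul_left_comm, ← Real.exp_add]
          ring_nf
      _ = Real.exp (-u) * (2 * Real.exp (-((2 * k + 1) * u))) := by
          rw [mul_left_comm, ← Real.exp_add]
          ring_nf
      _ ≤ Real.exp (-u) * (2 * Real.exp (-u) ^ (k + 1)) := by
          rw [← Real.exp_nat_mul]
          gcongr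
          push_cast
          have : 0 ≤ (k : ℝ) * u := by positivity
          linarith
      _ ≤ Real.exp (-u) * (2 * (1 / 4) ^ (k + 1)) := by gcongr
      _ ≤ Real.exp (-u) * (1 / 2) ^ (k + 1) := by
          gcongr
          rw [show (1 / 4 : ℝ) = 1 / 2 * (1 / 2) by norm_num, mul_pow, ← mul_assoc]
          refine mul_le_of_le_one_left (by positivity) ?_
          rw [pow_succ]
          have : ((1 : ℝ) / 2) ^ k ≤ 1 := pow_le_one₀ (by norm_num) (by norm_num)
          linarith
  have hsum : HasSum (fun k : ℕ => Real.exp (-u) * (1 / 2) ^ (k + 1)) (Real.exp (-u)) := by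
    have := hasSum_geometric_two.mul_left (Real.exp (-u) * (1 / 2))
    rw [mul_assoc, show (1 / 2 : ℝ) * 2 = 1 by norm_num, mul_one] at this
    simpa only [pow_succ', mul_assoc] using this
  calc _ ≤ M (⋃ k, ⋃ l ∈ links k, bad k l) := measure_mono hsub
    _ ≤ ∑' k, M (⋃ l ∈ links k, bad k l) := measure_iUnion_le _
    _ ≤ ∑' k : ℕ, ENNReal.ofReal (Real.exp (-u) * (1 / 2) ^ (k + 1)) := ENNReal.tsum_le_tsum hlevel
    _ = ENNReal.ofReal (Real.exp (-u)) := by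
        rw [← ENNReal.ofReal_tsum_of_nonneg (fun k => by positivity) hsum.summable, hsum.tsum_eq]

/-- Uniform localized concentration by peeling over dyadic radii. -/
theorem measure_pi_exists_deviation_gt_max_le {X : Set E} {g : E → Z → H} {L R A δ : ℝ} (hL : 0 < L)
    (hg : ∀ x ∈ X, Integrable (g x) P)
    (hlip : ∀ x ∈ X, ∀ x' ∈ X, ∀ z, ‖g x z - g x' z‖ ≤ L * ‖x - x'‖) {n : ℕ} (hn : 0 < n)
    {x₀ : E} (hx₀ : x₀ ∈ X) (hR : ∀ x ∈ X, ‖x - x₀‖ ≤ R) (hA1 : 1 ≤ A)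
    (hA : Real.logb 2 (max (n * R) 1) ≤ A) (hδ : 0 < δ) (hδ1 : δ < 1) :
    Measure.pi (fun _ : Fin n => P)
        {S | ∃ x ∈ X, 32 * L * max ‖x - x₀‖ (1 / (n : ℝ))
            * (√((Module.finrank ℝ E + Real.log (16 * A / δ)) / n)
              + (Module.finrank ℝ E + Real.log (16 * A / δ)) / n)
          < ‖deviation P g S x - deviation P g S x₀‖}
      ≤ ENNReal.ofReal (3 / 16 * δ) := by
  have hn' : (0 : ℝ) < n := by exact_mod_cast hn
  set u := Module.finrank ℝ E + Real.log (16 * A / δ) with hu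
  set W := √(u / n) + u / n
  have h16 : 16 ≤ 16 * A / δ := by
    rw [le_div_iff₀ hδ]; nlinarith
  have hlog : 2 ≤ Real.log (16 * A / δ) := by
    rw [Real.le_log_iff_exp_le (by linarith)]
    have := Real.exp_one_lt_d9
    have h0 := Real.exp_pos 1
    refine le_trans ?_ h16
    rw [show (2 : ℝ) = 1 + 1 by norm_num, Real.exp_add]
    nlinarith
  have hfr : (0 : ℝ) ≤ Module.finrank ℝ E := Nat.cast_nonneg _
  have hexp : Real.exp (-u) ≤ δ / (16 * A) := by
    calc Real.exp (-u) ≤ Real.exp (-Real.log (16 * A / δ)) := by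
          apply Real.exp_le_exp.2; linarith
      _ = δ / (16 * A) := by
          rw [Real.exp_neg, Real.exp_log (by linarith), inv_div]
  have hu0 : 0 < u := by linarith
  have hW0 : 0 ≤ W := by positivity
  -- There are `J + 1 ≤ A + 2 ≤ 3 * A` radii, each failing with probability at most `δ / (16 * A)`.
  set J := ⌈A⌉₊
  have hsub : {S : Fin n → Z | ∃ x ∈ X, 32 * L * max ‖x - x₀‖ (1 / (n : ℝ)) * W
      < ‖deviation P g S x - deviation P g S x₀‖}
      ⊆ ⋃ j ∈ Finset.range (J + 1), {S | ∃ x ∈ X, ‖x - x₀‖ ≤ 2 ^ j / n ∧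
        16 * L * (2 ^ j / n) * W < ‖deviation P g S x - deviation P g S x₀‖} := by
    rintro S ⟨x, hx, hlt⟩
    set ρ := max ‖x - x₀‖ (1 / (n : ℝ)) with hρ
    have hnρ1 : 1 ≤ n * ρ := by
      have := mul_le_mul_of_nonneg_left (le_max_right ‖x - x₀‖ (1 / (n : ℝ))) hn'.le
      rwa [mul_one_div_cancel hn'.ne'] at this
    have hnρ2 : n * ρ ≤ max (n * R) 1 := by
      rw [hρ, mul_max_of_nonneg _ _ hn'.le, mul_one_div_cancel hn'.ne']
      exact max_le_max_right _ (mul_le_mul_of_nonneg_left (hR x hx) hn'.le)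
    have hpos : 0 < n * ρ := by linarith
    -- The least dyadic radius above `ρ`; it is at most `2 * ρ`, which doubles 16 to 32.
    set j := ⌈Real.logb 2 (n * ρ)⌉₊ with hj
    have hlogb0 : 0 ≤ Real.logb 2 (n * ρ) := Real.logb_nonneg (by norm_num) hnρ1
    have hjJ : j ≤ J := Nat.ceil_le_ceil
      ((Real.logb_le_logb_of_le (by norm_num) hpos hnρ2).trans hA)
    have hj1 : n * ρ ≤ 2 ^ j := by
      rw [← Real.rpow_natCast, ← Real.logb_le_iff_le_rpow (by norm_num) hpos]
      exact Nat.le_ceil _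
    have hj2 : (2 : ℝ) ^ j ≤ 2 * (n * ρ) := by
      rw [← Real.rpow_natCast, ← Real.le_logb_iff_rpow_le (by norm_num) (by linarith),
        Real.logb_mul (by norm_num) hpos.ne', Real.logb_self_eq_one (by norm_num)]
      linarith [Nat.ceil_lt_add_one hlogb0]
    refine Set.mem_biUnion (Finset.mem_coe.2 (Finset.mem_range.2 (Nat.lt_succ_of_le hjJ)))
      ⟨x, hx, ?_, ?_⟩
    · rw [le_div_iff₀ hn', mul_comm]
      exact (mul_le_mul_of_nonneg_left (le_max_left _ _) hn'.le).trans hj1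
    · refine lt_of_le_of_lt ?_ hlt
      have h2 : (2 : ℝ) ^ j / n ≤ 2 * ρ := by
        rw [div_le_iff₀ hn']; linarith
      have := mul_le_mul_of_nonneg_left h2 (show 0 ≤ 16 * L by positivity)
      refine mul_le_mul_of_nonneg_right ?_ hW0
      linarith
  refine (measure_mono hsub).trans ((measure_biUnion_finset_le _ _).trans
    ((Finset.sum_le_card_nsmul _ _ _ fun j _ => measure_pi_exists_deviation_gt_le (u := u) hL hg hlip
      hn hx₀ (show (0 : ℝ) < 2 ^ j / n by positivity) (by linarith) (by linarith)).trans ?_))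
  rw [nsmul_eq_mul, ← ENNReal.ofReal_natCast, ← ENNReal.ofReal_mul (by positivity)]
  apply ENNReal.ofReal_le_ofReal
  have hJ : ((Finset.range (J + 1)).card : ℝ) ≤ 3 * A := by
    rw [Finset.card_range]
    push_cast
    linarith [Nat.ceil_lt_add_one (show 0 ≤ A by linarith)]
  calc _ ≤ 3 * A * (δ / (16 * A)) := by gcongr
    _ = 3 / 16 * δ := by field_simp

end Chaining

/-! ### Smoothness and strong concavity in a form stable under averaging. -/

section Smooth

theorem primal_eq_of_isMaxOn {E E' : Type*} {F : E → E' → ℝ} {Y : Set E'} {x : E} {y : E'} (hy : y ∈ Y) (hmax : IsMaxOn (F x) Y y) :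
    primal F Y x = F x y :=
  IsGreatest.csSup_eq ⟨Set.mem_image_of_mem _ hy, by
    rintro _ ⟨y', hy', rfl⟩
    exact hmax hy'⟩

variable {E : Type*} [NormedAddCommGroup E] [InnerProductSpace ℝ E] [CompleteSpace E]
  {E' : Type*} [NormedAddCommGroup E'] [InnerProductSpace ℝ E'] [CompleteSpace E']

/-- Quadratic remainder bounds survive integration in a parameter; this recovers the gradient from
them without differentiating under the integral. -/
theorem hasGradientWithinAt_of_quadratic {f : E → ℝ} {s : Set E} {g x : E} {C : ℝ}
    (h : ∀ y ∈ s, |f y - f x - inner ℝ g (y - x)| ≤ C * ‖y - x‖ ^ 2) :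
    HasGradientWithinAt f g s x := by
  rw [hasGradientWithinAt_iff_hasFDerivWithinAt, hasFDerivWithinAt_iff_isLittleO]
  have h1 : (fun y => f y - f x - (InnerProductSpace.toDual ℝ E g) (y - x))
      =O[nhdsWithin x s] fun y => ‖y - x‖ ^ 2 := by
    refine Asymptotics.IsBigO.of_bound C ?_
    filter_upwards [self_mem_nhdsWithin] with y hy
    rw [InnerProductSpace.toDual_apply_apply, Real.norm_eq_abs, norm_pow, norm_norm]
    exact h y hy
  have h2 : (fun y : E => ‖y - x‖ ^ 2) =o[nhdsWithin x s] fun y => y - x :=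
    (Asymptotics.isLittleO_norm_pow_id (E' := E) one_lt_two).comp_tendsto
      ((tendsto_sub_nhds_zero_iff.2 Filter.tendsto_id).mono_left nhdsWithin_le_nhds)
  exact h1.trans_isLittleO h2

/-- The mean value inequality on the segment, applied with the derivative at `x` subtracted. The
sharper `C / 2` is not needed, since the bound serves only to establish differentiability. -/
theorem abs_sub_sub_inner_le_of_lipschitz {f : E → ℝ} {s : Set E} {g : E → E} {C : ℝ}
    (hs : Convex ℝ s) (hg : ∀ x ∈ s, HasGradientWithinAt f (g x) s x)
    (hlip : ∀ x ∈ s, ∀ y ∈ s, ‖g x - g y‖ ≤ C * ‖x - y‖) (hC : 0 ≤ C) {x y : E} (hx : x ∈ s)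
    (hy : y ∈ s) : |f y - f x - inner ℝ (g x) (y - x)| ≤ C * ‖y - x‖ ^ 2 := by
  have hseg : segment ℝ x y ⊆ s := hs.segment_subset hx hy
  have h := (convex_segment x y).norm_image_sub_le_of_norm_hasFDerivWithin_le'
    (f := f) (f' := fun w => InnerProductSpace.toDual ℝ E (g w))
    (φ := InnerProductSpace.toDual ℝ E (g x)) (C := C * ‖y - x‖)
    (fun w hw => (hg w (hseg hw)).hasFDerivWithinAt.mono hseg)
    (fun w hw => by
      rw [← map_sub, LinearIsometryEquiv.norm_map]
      refine (hlip w (hseg hw) x hx).trans (mul_le_mul_of_nonneg_left ?_ hC)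
      exact norm_sub_le_of_mem_segment hw)
    (left_mem_segment ℝ x y) (right_mem_segment ℝ x y)
  rw [InnerProductSpace.toDual_apply_apply, Real.norm_eq_abs] at h
  calc _ ≤ _ := h
    _ = _ := by ring

/-- A smooth function on `X × Y`, strongly concave in its second argument, with the partial
gradients `Gx` and `Gy`. -/
structure SmoothConcave (X : Set E) (Y : Set E') (F : E → E' → ℝ) (Gx : E → E' → E)
    (Gy : E → E' → E') (μ β : ℝ) : Prop where
  isCompact_right : IsCompact Y
  convex_right : Convex ℝ Y
  mem_vectorSpan : ∀ x ∈ X, ∀ y ∈ Y, Gx x y ∈ vectorSpan ℝ X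
  quadratic_left : ∀ x ∈ X, ∀ x' ∈ X, ∀ y ∈ Y,
    |F x' y - F x y - inner ℝ (Gx x y) (x' - x)| ≤ β * ‖x' - x‖ ^ 2
  quadratic_right : ∀ x ∈ X, ∀ y ∈ Y, ∀ y' ∈ Y,
    |F x y' - F x y - inner ℝ (Gy x y) (y' - y)| ≤ β * ‖y' - y‖ ^ 2
  concave : ∀ x ∈ X, ∀ y ∈ Y, ∀ y' ∈ Y,
    F x y' ≤ F x y + inner ℝ (Gy x y) (y' - y) - μ / 2 * ‖y' - y‖ ^ 2
  lipschitz_left : ∀ x ∈ X, ∀ x' ∈ X, ∀ y ∈ Y, ∀ y' ∈ Y,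
    ‖Gx x y - Gx x' y'‖ ≤ β * (‖x - x'‖ + ‖y - y'‖)
  lipschitz_right : ∀ x ∈ X, ∀ x' ∈ X, ∀ y ∈ Y, ∀ y' ∈ Y,
    ‖Gy x y - Gy x' y'‖ ≤ β * (‖x - x'‖ + ‖y - y'‖)

theorem NCSC.smoothConcave {Z : Type*} {X : Set E} {Y : Set E'} {f : E → E' → Z → ℝ}
    {gx : E → E' → Z → E} {gy : E → E' → Z → E'} {μ β : ℝ} (h : NCSC X Y f gx gy μ β) (z : Z) :
    SmoothConcave X Y (fun x y => f x y z) (fun x y => gx x y z) (fun x y => gy x y z) μ β := by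
  have hsq : ∀ a b : ℝ, 0 ≤ a → 0 ≤ b → √(a ^ 2 + b ^ 2) ≤ a + b := fun a b ha hb => by
    rw [Real.sqrt_le_left (by positivity)]
    nlinarith [mul_nonneg ha hb]
  have hx : ∀ x ∈ X, ∀ x' ∈ X, ∀ y ∈ Y, ∀ y' ∈ Y,
      ‖gx x y z - gx x' y' z‖ ≤ β * (‖x - x'‖ + ‖y - y'‖) := fun x hx x' hx' y hy y' hy' =>
    ((Real.le_sqrt (norm_nonneg _) (by positivity)).2 (by linarith [sq_nonneg ‖gy x y z - gy x' y' z‖])).trans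
      ((h.smooth x hx x' hx' y hy y' hy' z).trans
        (mul_le_mul_of_nonneg_left (hsq _ _ (norm_nonneg _) (norm_nonneg _)) h.pos_smooth.le))
  have hy : ∀ x ∈ X, ∀ x' ∈ X, ∀ y ∈ Y, ∀ y' ∈ Y,
      ‖gy x y z - gy x' y' z‖ ≤ β * (‖x - x'‖ + ‖y - y'‖) := fun x hx x' hx' y hy y' hy' =>
    ((Real.le_sqrt (norm_nonneg _) (by positivity)).2 (by linarith [sq_nonneg ‖gx x y z - gx x' y' z‖])).trans
      ((h.smooth x hx x' hx' y hy y' hy' z).trans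
        (mul_le_mul_of_nonneg_left (hsq _ _ (norm_nonneg _) (norm_nonneg _)) h.pos_smooth.le))
  refine ⟨h.isCompact_right, h.convex_right, fun x hx y hy => (h.hasGrad_left x hx y hy z).1,
    fun x hxX x' hx' y hyY => ?_, fun x hxX y hyY y' hy' => ?_, fun x hxX y hyY y' hy' => ?_,
    hx, hy⟩
  · exact abs_sub_sub_inner_le_of_lipschitz (g := fun x => gx x y z) h.convex_left
      (fun w hw => (h.hasGrad_left w hw y hyY z).2)
      (fun w hw w' hw' => by simpa using hx w hw w' hw' y hyY y hyY) h.pos_smooth.le hxX hx'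
  · exact abs_sub_sub_inner_le_of_lipschitz (g := fun y => gy x y z) h.convex_right
      (fun w hw => (h.hasGrad_right x hxX w hw z).2)
      (fun w hw w' hw' => by simpa using hy x hxX x hxX w hw w' hw') h.pos_smooth.le hyY hy'
  · have := h.strongly_concave x hxX y' hy' y hyY z
    rw [inner_neg_left] at this
    linarith

theorem norm_integral_le_of_forall_norm_le {Z : Type*} [MeasurableSpace Z] {P : Measure Z}
    [IsProbabilityMeasure P] {V : Type*} [NormedAddCommGroup V] [NormedSpace ℝ V] {w : Z → V} {c : ℝ}
    (hw : ∀ z, ‖w z‖ ≤ c) : ‖∫ z, w z ∂P‖ ≤ c := by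
  simpa using norm_integral_le_of_norm_le_const (μ := P) (Filter.Eventually.of_forall hw)

/-- Every condition on `f` and its gradients is a bound on an expression linear in them, or
membership in a subspace, so it passes to the mean. -/
theorem SmoothConcave.integral {Z : Type*} [MeasurableSpace Z] {P : Measure Z}
    [IsProbabilityMeasure P] [FiniteDimensional ℝ E] {X : Set E} {Y : Set E'} {f : E → E' → Z → ℝ}
    {gx : E → E' → Z → E} {gy : E → E' → Z → E'} {μ β : ℝ}
    (h : ∀ z, SmoothConcave X Y (fun x y => f x y z) (fun x y => gx x y z) (fun x y => gy x y z) μ β)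
    (hf : ∀ x ∈ X, ∀ y ∈ Y, Integrable (fun z => f x y z) P)
    (hgx : ∀ x ∈ X, ∀ y ∈ Y, Integrable (fun z => gx x y z) P)
    (hgy : ∀ x ∈ X, ∀ y ∈ Y, Integrable (fun z => gy x y z) P) :
    SmoothConcave X Y (popRisk P f) (fun x y => ∫ z, gx x y z ∂P) (fun x y => ∫ z, gy x y z ∂P)
      μ β := by
  obtain ⟨z₀⟩ := (inferInstance : (ae P).NeBot).nonempty
  refine ⟨(h z₀).isCompact_right, (h z₀).convex_right, fun x hx y hy => ?_,
    fun x hx x' hx' y hy => ?_, fun x hx y hy y' hy' => ?_, fun x hx y hy y' hy' => ?_,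
    fun x hx x' hx' y hy y' hy' => ?_, fun x hx x' hx' y hy y' hy' => ?_⟩
  -- Finite dimension makes the span closed, so it contains the mean gradient.
  · exact (vectorSpan ℝ X).convex.integral_mem (Submodule.closed_of_finiteDimensional _)
      (Filter.Eventually.of_forall fun z => (h z).mem_vectorSpan x hx y hy) (hgx x hx y hy)
  · have hi : Integrable (fun z => f x' y z - f x y z) P := (hf x' hx' y hy).sub (hf x hx y hy)
    rw [popRisk, popRisk, real_inner_comm, ← integral_inner (hgx x hx y hy),
      ← integral_sub (hf x' hx' y hy) (hf x hx y hy),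
      ← integral_sub hi ((hgx x hx y hy).const_inner _)]
    rw [← Real.norm_eq_abs]
    refine norm_integral_le_of_forall_norm_le fun z => ?_
    rw [real_inner_comm, Real.norm_eq_abs]
    exact (h z).quadratic_left x hx x' hx' y hy
  · have hi : Integrable (fun z => f x y' z - f x y z) P := (hf x hx y' hy').sub (hf x hx y hy)
    rw [popRisk, popRisk, real_inner_comm, ← integral_inner (hgy x hx y hy),
      ← integral_sub (hf x hx y' hy') (hf x hx y hy),
      ← integral_sub hi ((hgy x hx y hy).const_inner _)]
    rw [← Real.norm_eq_abs]
    refine norm_integral_le_of_forall_norm_le fun z => ?_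
    rw [real_inner_comm, Real.norm_eq_abs]
    exact (h z).quadratic_right x hx y hy y' hy'
  · have hi : Integrable (fun z => f x y z + inner ℝ (y' - y) (gy x y z)) P :=
      (hf x hx y hy).add ((hgy x hx y hy).const_inner (𝕜 := ℝ) (y' - y))
    have hle : popRisk P f x y' ≤ ∫ z, (f x y z + inner ℝ (y' - y) (gy x y z)
        - μ / 2 * ‖y' - y‖ ^ 2) ∂P := by
      refine integral_mono (hf x hx y' hy') (hi.sub (integrable_const _)) fun z => ?_
      have := (h z).concave x hx y hy y' hy'
      rwa [real_inner_comm] at this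
    rw [integral_sub hi (integrable_const _), integral_add (hf x hx y hy)
      ((hgy x hx y hy).const_inner (𝕜 := ℝ) (y' - y)), integral_inner (hgy x hx y hy)] at hle
    rw [real_inner_comm]
    simpa [popRisk] using hle
  · rw [← integral_sub (hgx x hx y hy) (hgx x' hx' y' hy')]
    exact norm_integral_le_of_forall_norm_le fun z => (h z).lipschitz_left x hx x' hx' y hy y' hy'
  · rw [← integral_sub (hgy x hx y hy) (hgy x' hx' y' hy')]
    exact norm_integral_le_of_forall_norm_le fun z => (h z).lipschitz_right x hx x' hx' y hy y' hy'

theorem integral_uniform_fin {V : Type*} [NormedAddCommGroup V] [NormedSpace ℝ V] [CompleteSpace V]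
    (n : ℕ) (w : Fin n → V) :
    ∫ i, w i ∂((n : ENNReal)⁻¹ • Measure.count : Measure (Fin n)) = (1 / (n : ℝ)) • ∑ i, w i := by
  rw [integral_smul_measure, integral_count]
  simp

theorem isProbabilityMeasure_uniform_fin {n : ℕ} (hn : 0 < n) :
    IsProbabilityMeasure ((n : ENNReal)⁻¹ • Measure.count : Measure (Fin n)) := by
  constructor
  have : (n : ENNReal) ≠ 0 := by exact_mod_cast hn.ne'
  simp [Measure.count_univ, ENNReal.inv_mul_cancel this]

/-- An empirical risk is a population risk for the uniform measure on `Fin n`. -/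
theorem SmoothConcave.average {Z : Type*} [FiniteDimensional ℝ E] {X : Set E} {Y : Set E'}
    {f : E → E' → Z → ℝ} {gx : E → E' → Z → E} {gy : E → E' → Z → E'} {μ β : ℝ}
    (h : ∀ z, SmoothConcave X Y (fun x y => f x y z) (fun x y => gx x y z) (fun x y => gy x y z) μ β)
    {n : ℕ} (hn : 0 < n) (S : Fin n → Z) :
    SmoothConcave X Y (empRisk f S) (fun x y => (1 / (n : ℝ)) • ∑ i, gx x y (S i))
      (fun x y => (1 / (n : ℝ)) • ∑ i, gy x y (S i)) μ β := by
  have := isProbabilityMeasure_uniform_fin hn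
  have key := SmoothConcave.integral (P := ((n : ENNReal)⁻¹ • Measure.count : Measure (Fin n)))
    (f := fun x y i => f x y (S i)) (gx := fun x y i => gx x y (S i))
    (gy := fun x y i => gy x y (S i)) (fun i => h (S i)) (fun _ _ _ _ => Integrable.of_finite)
    (fun _ _ _ _ => Integrable.of_finite) (fun _ _ _ _ => Integrable.of_finite)
  simp only [integral_uniform_fin] at key
  convert key using 1
  funext x y
  rw [popRisk, integral_uniform_fin, empRisk, smul_eq_mul]

end Smooth

/-! ### Stability of maximizers and the gradient of the primal function. -/

namespace SmoothConcave

variable {E : Type*} [NormedAddCommGroup E] [InnerProductSpace ℝ E]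
  {E' : Type*} [NormedAddCommGroup E'] [InnerProductSpace ℝ E'] [CompleteSpace E']
  {X : Set E} {Y : Set E'} {F F' : E → E' → ℝ} {Gx Gx' : E → E' → E} {Gy Gy' : E → E' → E'}
  {μ β : ℝ}

theorem hasGradientWithinAt_right (h : SmoothConcave X Y F Gx Gy μ β) {x : E} (hx : x ∈ X) {y : E'}
    (hy : y ∈ Y) : HasGradientWithinAt (F x) (Gy x y) Y y :=
  hasGradientWithinAt_of_quadratic fun y' hy' => h.quadratic_right x hx y hy y' hy'

theorem exists_isMaxOn (h : SmoothConcave X Y F Gx Gy μ β) (hY : Y.Nonempty) {x : E} (hx : x ∈ X) :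
    ∃ y ∈ Y, IsMaxOn (F x) Y y :=
  h.isCompact_right.exists_isMaxOn hY fun _ hy =>
    (h.hasGradientWithinAt_right hx hy).hasFDerivWithinAt.continuousWithinAt

/-- The maximizer may lie on the boundary of `Y`, so first-order optimality is a variational
inequality. -/
theorem inner_nonpos_of_isMaxOn (h : SmoothConcave X Y F Gx Gy μ β) {x : E} (hx : x ∈ X) {y y' : E'}
    (hy : y ∈ Y) (hmax : IsMaxOn (F x) Y y) (hy' : y' ∈ Y) : inner ℝ (Gy x y) (y' - y) ≤ 0 := by
  have := hmax.localize.hasFDerivWithinAt_nonpos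
    (h.hasGradientWithinAt_right hx hy).hasFDerivWithinAt
    (sub_mem_posTangentConeAt_of_segment_subset (h.convex_right.segment_subset hy hy'))
  rwa [InnerProductSpace.toDual_apply_apply] at this

/-- The maximizer is stable under perturbations of the gradient. -/
theorem mul_norm_sub_le_of_isMaxOn (h : SmoothConcave X Y F Gx Gy μ β)
    (h' : SmoothConcave X Y F' Gx' Gy' μ β) {x x' : E} (hx : x ∈ X) (hx' : x' ∈ X) {y y' : E'}
    (hy : y ∈ Y) (hmax : IsMaxOn (F x) Y y) (hy' : y' ∈ Y) (hmax' : IsMaxOn (F' x') Y y') :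
    μ * ‖y - y'‖ ≤ ‖Gy x y - Gy' x' y‖ := by
  have h1 := h.inner_nonpos_of_isMaxOn hx hy hmax hy'
  have h2 := h'.inner_nonpos_of_isMaxOn hx' hy' hmax' hy
  have h3 := h'.concave x' hx' y hy y' hy'
  have h4 := h'.concave x' hx' y' hy' y hy
  have h5 := real_inner_le_norm (Gy x y - Gy' x' y) (y - y')
  rw [norm_sub_rev y' y] at h3
  have e1 : inner ℝ (Gy x y) (y' - y) = -inner ℝ (Gy x y) (y - y') := by
    rw [← inner_neg_right, neg_sub]
  have e2 : inner ℝ (Gy' x' y) (y' - y) = -inner ℝ (Gy' x' y) (y - y') := by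
    rw [← inner_neg_right, neg_sub]
  rw [inner_sub_left] at h5
  -- Adding `h3` and `h4` gives strong monotonicity of `Gy' x'`; the two optimality conditions then
  -- leave only the gradient difference at `y`.
  have h6 : μ * ‖y - y'‖ * ‖y - y'‖ ≤ ‖Gy x y - Gy' x' y‖ * ‖y - y'‖ := by nlinarith
  rcases (norm_nonneg (y - y')).eq_or_lt with h0 | h0
  · rw [← h0, mul_zero]; exact norm_nonneg _
  · exact le_of_mul_le_mul_right h6 h0

theorem eq_of_isMaxOn (h : SmoothConcave X Y F Gx Gy μ β) (hμ : 0 < μ) {x : E} (hx : x ∈ X)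
    {y y' : E'} (hy : y ∈ Y) (hmax : IsMaxOn (F x) Y y) (hy' : y' ∈ Y)
    (hmax' : IsMaxOn (F x) Y y') : y = y' := by
  have := h.mul_norm_sub_le_of_isMaxOn h hx hx hy hmax hy' hmax'
  rw [sub_self, norm_zero] at this
  have h0 : ‖y - y'‖ ≤ 0 := by
    by_contra! hc
    nlinarith
  exact sub_eq_zero.1 (norm_le_zero_iff.1 h0)

theorem norm_sub_le_of_isMaxOn (h : SmoothConcave X Y F Gx Gy μ β) (hμ : 0 < μ) {x x' : E}
    (hx : x ∈ X) (hx' : x' ∈ X) {y y' : E'} (hy : y ∈ Y) (hmax : IsMaxOn (F x) Y y) (hy' : y' ∈ Y)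
    (hmax' : IsMaxOn (F x') Y y') : ‖y - y'‖ ≤ β / μ * ‖x - x'‖ := by
  have h1 := h.mul_norm_sub_le_of_isMaxOn h hx hx' hy hmax hy' hmax'
  have h2 := h.lipschitz_right x hx x' hx' y hy y hy
  rw [sub_self, norm_zero, add_zero] at h2
  rw [div_mul_eq_mul_div, le_div_iff₀ hμ, mul_comm]
  exact h1.trans h2

/-- Danskin's theorem: the primal function is differentiable. -/
theorem hasGradOn_primal [CompleteSpace E] (h : SmoothConcave X Y F Gx Gy μ β) (hμ : 0 < μ) (hβ : 0 ≤ β) {x : E}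
    (hx : x ∈ X) {y : E'} (hy : y ∈ Y) (hmax : IsMaxOn (F x) Y y) :
    HasGradOn (primal F Y) X (Gx x y) x := by
  refine ⟨h.mem_vectorSpan x hx y hy, hasGradientWithinAt_of_quadratic (C := β * (β / μ) + β)
    fun x' hx' => ?_⟩
  obtain ⟨y', hy', hmax'⟩ := h.exists_isMaxOn ⟨y, hy⟩ hx'
  rw [primal_eq_of_isMaxOn hy hmax, primal_eq_of_isMaxOn hy' hmax']
  have h1 : F x' y ≤ F x' y' := hmax' hy
  have h2 : F x y' ≤ F x y := hmax hy'
  have h3 := abs_le.1 (h.quadratic_left x hx x' hx' y hy)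
  have h4 := abs_le.1 (h.quadratic_left x hx x' hx' y' hy')
  have h5 := h.lipschitz_left x hx x hx y' hy' y hy
  rw [sub_self, norm_zero, zero_add] at h5
  have h6 := h.norm_sub_le_of_isMaxOn hμ hx' hx hy' hmax' hy hmax
  have h7 : inner ℝ (Gx x y' - Gx x y) (x' - x) ≤ β * (β / μ) * ‖x' - x‖ ^ 2 :=
    -- The lower bound on the increment freezes `y`; the upper one freezes `y'`, and replacing `y'`
    -- by `y` in the gradient costs only a second-order term.
    calc _ ≤ ‖Gx x y' - Gx x y‖ * ‖x' - x‖ := real_inner_le_norm _ _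
      _ ≤ β * (β / μ * ‖x' - x‖) * ‖x' - x‖ := by
        gcongr
        exact h5.trans (mul_le_mul_of_nonneg_left h6 hβ)
      _ = _ := by ring
  rw [inner_sub_left] at h7
  have h8 : 0 ≤ β * (β / μ) * ‖x' - x‖ ^ 2 := by positivity
  rw [abs_le]
  constructor <;> linarith

/-- The comparison goes through `Gx' x y`, so both errors are evaluated at the maximizer of `F x`.
With `F` the population risk this point is independent of the sample. -/
theorem norm_grad_sub_le (h : SmoothConcave X Y F Gx Gy μ β) (h' : SmoothConcave X Y F' Gx' Gy' μ β)
    (hμ : 0 < μ) (hβ : 0 ≤ β) {x : E} (hx : x ∈ X) {y y' : E'} (hy : y ∈ Y)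
    (hmax : IsMaxOn (F x) Y y) (hy' : y' ∈ Y) (hmax' : IsMaxOn (F' x) Y y') :
    ‖Gx x y - Gx' x y'‖ ≤ ‖Gx' x y - Gx x y‖ + β / μ * ‖Gy' x y - Gy x y‖ := by
  have h1 := h.mul_norm_sub_le_of_isMaxOn h' hx hx hy hmax hy' hmax'
  have h2 := h'.lipschitz_left x hx x hx y hy y' hy'
  rw [sub_self, norm_zero, zero_add] at h2
  have h3 : β * ‖y - y'‖ ≤ β / μ * ‖Gy' x y - Gy x y‖ := by
    rw [norm_sub_rev (Gy' x y), div_mul_eq_mul_div, le_div_iff₀ hμ, mul_assoc, mul_comm _ μ]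
    exact mul_le_mul_of_nonneg_left h1 hβ
  have h4 := norm_sub_le_norm_sub_add_norm_sub (Gx x y) (Gx' x y) (Gx' x y')
  rw [norm_sub_rev (Gx x y) (Gx' x y)] at h4
  linarith

end SmoothConcave

/-! ### Measurability of the gradients. -/

/-- Gradients of a parametrized function are measurable in the parameter. -/
theorem aestronglyMeasurable_of_hasGradOn {E : Type*} [NormedAddCommGroup E]
    [InnerProductSpace ℝ E] [FiniteDimensional ℝ E] {Z : Type*} [MeasurableSpace Z]
    {P : Measure Z} {X : Set E} (hX : Convex ℝ X) {f : E → Z → ℝ}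
    (hf : ∀ x ∈ X, AEStronglyMeasurable (f x) P) {x : E} (hx : x ∈ X) {g : Z → E}
    (hg : ∀ z, HasGradOn (fun x' => f x' z) X (g z) x) : AEStronglyMeasurable g P := by
  have hdir : ∀ y ∈ X, AEStronglyMeasurable (fun z => inner ℝ (g z) (y - x)) P := by
    intro y hy
    have hmem : ∀ k : ℕ, x + (1 / ((k : ℝ) + 1)) • (y - x) ∈ X := fun k =>
      hX.add_smul_sub_mem hx hy ⟨by positivity, by
        rw [div_le_one (by positivity)]
        linarith [Nat.cast_nonneg (α := ℝ) k]⟩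
    -- Directional derivatives are limits of difference quotients whose base points stay in `X` by
    -- convexity.
    refine aestronglyMeasurable_of_tendsto_ae Filter.atTop
      (f := fun (k : ℕ) z => ((k : ℝ) + 1) • (f (x + (1 / ((k : ℝ) + 1)) • (y - x)) z - f x z))
      (fun k => ((hf _ (hmem k)).sub (hf x hx)).const_smul ((k : ℝ) + 1))
      (Filter.Eventually.of_forall fun z => ?_)
    have h := (hg z).2.hasFDerivWithinAt.lim (l := Filter.atTop)
      (c := fun k : ℕ => (k : ℝ) + 1) (d := fun k : ℕ => (1 / ((k : ℝ) + 1)) • (y - x)) (v := y - x)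
      ?_ (Filter.Eventually.of_forall hmem) ?_
    · rwa [InnerProductSpace.toDual_apply_apply] at h
    · have := (tendsto_one_div_add_atTop_nhds_zero_nat (𝕜 := ℝ)).smul_const (y - x)
      rwa [zero_smul] at this
    · refine tendsto_const_nhds.congr fun k => ?_
      rw [smul_smul, mul_one_div_cancel (by positivity), one_smul]
  have hspan : ∀ v ∈ vectorSpan ℝ X, AEStronglyMeasurable (fun z => inner ℝ (g z) v) P := by
    intro v hv
    rw [vectorSpan_eq_span_vsub_set_right ℝ hx] at hv
    induction hv using Submodule.span_induction with
    | mem v hv =>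
      obtain ⟨y, hy, rfl⟩ := hv
      exact hdir y hy
    | zero => simpa using aestronglyMeasurable_const
    | add u v _ _ hu hv =>
      simp only [inner_add_right]
      exact hu.add hv
    | smul a u _ hu =>
      simp only [inner_smul_right]
      exact hu.const_mul a
  have hall : ∀ v : E, AEStronglyMeasurable (fun z => inner ℝ (g z) v) P := by
    intro v
    -- Since `g z` lies in the span, only the projection of `v` to it matters.
    refine (hspan _ ((vectorSpan ℝ X).starProjection_apply_mem v)).congr
      (Filter.Eventually.of_forall fun z => ?_)
    show inner ℝ (g z) ((vectorSpan ℝ X).starProjection v) = inner ℝ (g z) v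
    rw [← Submodule.inner_starProjection_left_eq_right,
      Submodule.starProjection_eq_self_iff.2 (hg z).1]
  let b := stdOrthonormalBasis ℝ E
  have e : g = fun z => ∑ i, inner ℝ (g z) (b i) • b i := by
    funext z
    conv_lhs => rw [← b.sum_repr' (g z)]
    exact Finset.sum_congr rfl fun i _ => by rw [real_inner_comm]
  rw [e]
  exact Finset.aestronglyMeasurable_fun_sum _ fun i _ => (hall (b i)).smul_const _

/-! ### Assembly of the high-probability bound. -/

section Main

variable {E : Type*} [NormedAddCommGroup E] [InnerProductSpace ℝ E] [FiniteDimensional ℝ E]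
  {E' : Type*} [NormedAddCommGroup E'] [InnerProductSpace ℝ E'] [FiniteDimensional ℝ E']
  {Z : Type*} [MeasurableSpace Z] {P : Measure Z} [IsProbabilityMeasure P]

theorem Bernstein.integrable_self {V : Type*} [NormedAddCommGroup V] {v : Z → V} {B : ℝ} (h : Bernstein P v B)
    (hv : AEStronglyMeasurable v P) : Integrable v P :=
  ((memLp_two_iff_integrable_sq_norm hv).2 (h.integrable 2 le_rfl)).integrable (by norm_num)

omit [FiniteDimensional ℝ E] in
theorem Bernstein.measure_pi_deviation_gt_le [CompleteSpace E] {v : Z → E} {B δ : ℝ}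
    (h : Bernstein P v B) (hv : AEStronglyMeasurable v P) (hδ : 0 < δ) (hδ1 : δ < 1) {n : ℕ}
    (hn : 0 < n) :
    Measure.pi (fun _ : Fin n => P)
        {S | √(2 * (∫ z, ‖v z‖ ^ 2 ∂P) * Real.log (8 / δ) / n) + B * Real.log (8 / δ) / n
          < ‖(1 / (n : ℝ)) • ∑ i, v (S i) - ∫ z, v z ∂P‖} ≤ ENNReal.ofReal (δ / 4) := by
  have hlog : 0 < Real.log (8 / δ) := Real.log_pos (by rw [lt_div_iff₀ hδ]; linarith)
  refine (measure_pi_norm_average_sub_gt_le hv (integral_nonneg fun z => by positivity) h.pos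
    h.integrable h.moment_le hlog hn).trans (ENNReal.ofReal_le_ofReal (le_of_eq ?_))
  -- At level `log (8 / δ)` the tail `2 * exp (-L)` equals `δ / 4`.
  rw [Real.exp_neg, Real.exp_log (by positivity)]
  field_simp
  norm_num

omit [IsProbabilityMeasure P] in
theorem NCSC.aestronglyMeasurable_grad {X : Set E} {Y : Set E'} {f : E → E' → Z → ℝ}
    {gx : E → E' → Z → E} {gy : E → E' → Z → E'} {μ β : ℝ} (h : NCSC X Y f gx gy μ β)
    (hf : ∀ x ∈ X, ∀ y ∈ Y, Integrable (fun z => f x y z) P) {x : E} (hx : x ∈ X) {y : E'}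
    (hy : y ∈ Y) :
    AEStronglyMeasurable (fun z => gx x y z) P ∧ AEStronglyMeasurable (fun z => gy x y z) P :=
  ⟨aestronglyMeasurable_of_hasGradOn (f := fun x z => f x y z) h.convex_left
      (fun x' hx' => (hf x' hx' y hy).aestronglyMeasurable) hx (h.hasGrad_left x hx y hy),
    aestronglyMeasurable_of_hasGradOn (f := fun y z => f x y z) h.convex_right
      (fun y' hy' => (hf x hx y' hy').aestronglyMeasurable) hy (h.hasGrad_right x hx y hy)⟩

/-- Moments are available only at `(x₀, y₀)`; by smoothness, gradients elsewhere differ from those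
by a bounded function. -/
theorem NCSC.integrable_grad {X : Set E} {Y : Set E'} {f : E → E' → Z → ℝ}
    {gx : E → E' → Z → E} {gy : E → E' → Z → E'} {μ β : ℝ} (h : NCSC X Y f gx gy μ β)
    (hf : ∀ x ∈ X, ∀ y ∈ Y, Integrable (fun z => f x y z) P) {x₀ : E} (hx₀ : x₀ ∈ X) {y₀ : E'}
    (hy₀ : y₀ ∈ Y) (hgx : Integrable (fun z => gx x₀ y₀ z) P)
    (hgy : Integrable (fun z => gy x₀ y₀ z) P) {x : E} (hx : x ∈ X) {y : E'} (hy : y ∈ Y) :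
    Integrable (fun z => gx x y z) P ∧ Integrable (fun z => gy x y z) P := by
  obtain ⟨m1, m2⟩ := h.aestronglyMeasurable_grad hf hx hy
  constructor
  · have hd : Integrable (fun z => gx x y z - gx x₀ y₀ z) P :=
      Integrable.of_bound (m1.sub hgx.aestronglyMeasurable) (β * (‖x - x₀‖ + ‖y - y₀‖))
        (Filter.Eventually.of_forall fun z =>
          (h.smoothConcave z).lipschitz_left x hx x₀ hx₀ y hy y₀ hy₀)
    exact (hd.add hgx).congr (Filter.Eventually.of_forall fun z => sub_add_cancel _ _)
  · have hd : Integrable (fun z => gy x y z - gy x₀ y₀ z) P :=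
      Integrable.of_bound (m2.sub hgy.aestronglyMeasurable) (β * (‖x - x₀‖ + ‖y - y₀‖))
        (Filter.Eventually.of_forall fun z =>
          (h.smoothConcave z).lipschitz_right x hx x₀ hx₀ y hy y₀ hy₀)
    exact (hd.add hgy).congr (Filter.Eventually.of_forall fun z => sub_add_cancel _ _)

/-- Uniform localized convergence of the gradients of the primal functions. -/
theorem NCSC.measure_pi_grad_primal_sub_gt_le {X : Set E} {Y : Set E'} {f : E → E' → Z → ℝ}
    {gx : E → E' → Z → E} {gy : E → E' → Z → E'} {μ β Bx By R δ : ℝ} {n : ℕ} {x₀ : E} {y₀ : E'}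
    (h : NCSC X Y f gx gy μ β) (hf : ∀ x ∈ X, ∀ y ∈ Y, Integrable (fun z => f x y z) P)
    (hsol : IsMinimaxSolution (popRisk P f) X Y x₀ y₀)
    (hBx : Bernstein P (fun z => gx x₀ y₀ z) Bx) (hBy : Bernstein P (fun z => gy x₀ y₀ z) By)
    (hR : X ⊆ Metric.closedBall x₀ R) (hRn : 1 ≤ √2 * R * n) (hδ : 0 < δ) (hδ1 : δ < 1) :
    Measure.pi (fun _ : Fin n => P)
      {S | ¬ ∀ x ∈ X, ∃ G GS : E,
        HasGradOn (primal (popRisk P f) Y) X G x ∧ HasGradOn (primal (empRisk f S) Y) X GS x ∧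
        ‖G - GS‖ ≤
          β / μ * (√(2 * (∫ z, ‖gy x₀ y₀ z‖ ^ 2 ∂P) * Real.log (8 / δ) / n)
              + By * Real.log (8 / δ) / n)
            + (√(2 * (∫ z, ‖gx x₀ y₀ z‖ ^ 2 ∂P) * Real.log (8 / δ) / n)
              + Bx * Real.log (8 / δ) / n)
            + 32 * β * (μ + β) / μ * ((μ + β) / μ) * max ‖x - x₀‖ (1 / (n : ℝ))
              * (√((Module.finrank ℝ E + Real.log (16 * Real.logb 2 (√2 * R * n + 1) / δ)) / n)
                + (Module.finrank ℝ E + Real.log (16 * Real.logb 2 (√2 * R * n + 1) / δ)) / n)}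
      ≤ ENNReal.ofReal δ := by
  have hμ := h.pos_concave
  have hβ := h.pos_smooth
  have hx₀ := hsol.mem_left
  have hy₀ := hsol.mem_right
  have hn : 0 < n := by
    rcases Nat.eq_zero_or_pos n with rfl | hn
    · norm_num at hRn
    · exact hn
  have hn' : (0 : ℝ) < n := by exact_mod_cast hn
  have hRn0 : 0 ≤ R * n := by
    by_contra! hc
    have : √2 * (R * n) ≤ 0 := mul_nonpos_of_nonneg_of_nonpos (Real.sqrt_nonneg _) hc.le
    linarith [mul_assoc √2 R (n : ℝ)]
  obtain ⟨mx, my⟩ := h.aestronglyMeasurable_grad hf hx₀ hy₀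
  have hgx : ∀ x ∈ X, ∀ y ∈ Y, Integrable (fun z => gx x y z) P := fun x hx y hy =>
    (h.integrable_grad hf hx₀ hy₀ (hBx.integrable_self mx) (hBy.integrable_self my) hx hy).1
  have hgy : ∀ x ∈ X, ∀ y ∈ Y, Integrable (fun z => gy x y z) P := fun x hx y hy =>
    (h.integrable_grad hf hx₀ hy₀ (hBx.integrable_self mx) (hBy.integrable_self my) hx hy).2
  have hpop := SmoothConcave.integral h.smoothConcave hf hgx hgy
  choose! yst hyst hmax using fun x (hx : x ∈ X) => hpop.exists_isMaxOn ⟨y₀, hy₀⟩ hx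
  -- Uniqueness of the maximizer makes the increments start at the point where the Bernstein
  -- condition holds.
  have hyst₀ : yst x₀ = y₀ :=
    hpop.eq_of_isMaxOn hμ hx₀ (hyst x₀ hx₀) (hmax x₀ hx₀) hy₀ hsol.isMaxOn
  have hL : 0 < β * (1 + β / μ) := by positivity
  have hylip : ∀ x ∈ X, ∀ x' ∈ X,
      β * (‖x - x'‖ + ‖yst x - yst x'‖) ≤ β * (1 + β / μ) * ‖x - x'‖ := fun x hx x' hx' => by
    have := hpop.norm_sub_le_of_isMaxOn hμ hx hx' (hyst x hx) (hmax x hx) (hyst x' hx') (hmax x' hx')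
    calc _ ≤ β * (‖x - x'‖ + β / μ * ‖x - x'‖) := by gcongr
      _ = _ := by ring
  set A := Real.logb 2 (√2 * R * n + 1) with hA
  -- By `hRn` the argument of the logarithm is at least 2.
  have hA1 : 1 ≤ A := by
    rw [hA, Real.le_logb_iff_rpow_le (by norm_num) (by linarith), Real.rpow_one]
    linarith
  have hAR : Real.logb 2 (max (n * R) 1) ≤ A := by
    refine Real.logb_le_logb_of_le (by norm_num) (by positivity) (max_le ?_ (by linarith))
    have h1 : 1 * (R * n) ≤ √2 * (R * n) :=
      mul_le_mul_of_nonneg_right (Real.one_le_sqrt.2 (by norm_num)) hRn0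
    linarith [mul_assoc √2 R (n : ℝ), mul_comm R (n : ℝ)]
  have hRX : ∀ x ∈ X, ‖x - x₀‖ ≤ R := fun x hx => mem_closedBall_iff_norm.1 (hR hx)
  have b1 := hBx.measure_pi_deviation_gt_le mx hδ hδ1 hn
  have b2 := hBy.measure_pi_deviation_gt_le my hδ hδ1 hn
  have b3 := measure_pi_exists_deviation_gt_max_le (P := P) (g := fun x z => gx x (yst x) z)
    hL (fun x hx => hgx x hx _ (hyst x hx))
    (fun x hx x' hx' z => ((h.smoothConcave z).lipschitz_left x hx x' hx' _ (hyst x hx) _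
      (hyst x' hx')).trans (hylip x hx x' hx')) hn hx₀ hRX hA1 hAR hδ hδ1
  have b4 := measure_pi_exists_deviation_gt_max_le (P := P) (g := fun x z => gy x (yst x) z)
    hL (fun x hx => hgy x hx _ (hyst x hx))
    (fun x hx x' hx' z => ((h.smoothConcave z).lipschitz_right x hx x' hx' _ (hyst x hx) _
      (hyst x' hx')).trans (hylip x hx x' hx')) hn hx₀ hRX hA1 hAR hδ hδ1
  set M := Measure.pi (fun _ : Fin n => P)
  set W := √((Module.finrank ℝ E + Real.log (16 * A / δ)) / n)
    + (Module.finrank ℝ E + Real.log (16 * A / δ)) / n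
  set Tx := √(2 * (∫ z, ‖gx x₀ y₀ z‖ ^ 2 ∂P) * Real.log (8 / δ) / n) + Bx * Real.log (8 / δ) / n
  set Ty := √(2 * (∫ z, ‖gy x₀ y₀ z‖ ^ 2 ∂P) * Real.log (8 / δ) / n) + By * Real.log (8 / δ) / n
  -- Only monotonicity and subadditivity are used, so the exceptional set need not be measurable.
  refine (measure_mono (t := ((_ ∪ _) ∪ (_ ∪ _))) fun S hS => ?_).trans
    ((measure_union_le _ _).trans ((add_le_add ((measure_union_le _ _).trans (add_le_add b1 b2))
      ((measure_union_le _ _).trans (add_le_add b3 b4))).trans ?_))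
  · by_contra hcon
    simp only [Set.mem_union, Set.mem_ofPred_eq, not_or, not_exists, not_and, not_lt] at hcon
    obtain ⟨⟨c1, c2⟩, c3, c4⟩ := hcon
    refine hS fun x hx => ?_
    have hemp := SmoothConcave.average h.smoothConcave hn S
    obtain ⟨y', hy', hmax'⟩ := hemp.exists_isMaxOn ⟨y₀, hy₀⟩ hx
    refine ⟨_, _, hpop.hasGradOn_primal hμ hβ.le hx (hyst x hx) (hmax x hx),
      hemp.hasGradOn_primal hμ hβ.le hx hy' hmax', ?_⟩
    refine (hpop.norm_grad_sub_le hemp hμ hβ.le hx (hyst x hx) (hmax x hx) hy' hmax').trans ?_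
    have d3 := c3 x hx
    have d4 := c4 x hx
    simp only [deviation, hyst₀] at d3 d4
    have e3 := (norm_le_norm_add_norm_sub' ((1 / (n : ℝ)) • ∑ i, gx x (yst x) (S i)
      - ∫ z, gx x (yst x) z ∂P) ((1 / (n : ℝ)) • ∑ i, gx x₀ y₀ (S i) - ∫ z, gx x₀ y₀ z ∂P)).trans
      (add_le_add c1 d3)
    have e4 := (norm_le_norm_add_norm_sub' ((1 / (n : ℝ)) • ∑ i, gy x (yst x) (S i)
      - ∫ z, gy x (yst x) z ∂P) ((1 / (n : ℝ)) • ∑ i, gy x₀ y₀ (S i) - ∫ z, gy x₀ y₀ z ∂P)).trans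
      (add_le_add c2 d4)
    -- The increment terms add up to `32 * β * (1 + β / μ)` times `1 + β / μ`: one factor is the
    -- Lipschitz constant, the other combines the errors of the two gradients.
    refine (add_le_add e3 (mul_le_mul_of_nonneg_left e4 (by positivity))).trans (le_of_eq ?_)
    field_simp
    ring
  -- The four events have total probability at most `δ / 4 + δ / 4 + 3 * δ / 16 + 3 * δ / 16 = 7 * δ
  -- / 8`.
  · rw [← ENNReal.ofReal_add (by positivity) (by positivity),
      ← ENNReal.ofReal_add (by positivity) (by positivity),
      ← ENNReal.ofReal_add (by positivity) (by positivity)]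
    exact ENNReal.ofReal_le_ofReal (by linarith)

end Main

end Minimax

theorem theorem1 :
    ∃ C : ℝ, 0 < C ∧
      ∀ (d d' n : ℕ) (Z : Type*) [MeasurableSpace Z] (P : Measure Z) [IsProbabilityMeasure P]
        (X : Set (EuclideanSpace ℝ (Fin d))) (Y : Set (EuclideanSpace ℝ (Fin d')))
        (f : EuclideanSpace ℝ (Fin d) → EuclideanSpace ℝ (Fin d') → Z → ℝ)
        (gx : EuclideanSpace ℝ (Fin d) → EuclideanSpace ℝ (Fin d') → Z → EuclideanSpace ℝ (Fin d))
        (gy : EuclideanSpace ℝ (Fin d) → EuclideanSpace ℝ (Fin d') → Z → EuclideanSpace ℝ (Fin d'))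
        (μ β : ℝ) (x₀ : EuclideanSpace ℝ (Fin d)) (y₀ : EuclideanSpace ℝ (Fin d'))
        (Bx By R₁ δ : ℝ),
        Minimax.NCSC X Y f gx gy μ β →
        (∀ x ∈ X, ∀ y ∈ Y, Integrable (fun z => f x y z) P) →
        Minimax.IsMinimaxSolution (Minimax.popRisk P f) X Y x₀ y₀ →
        Minimax.Bernstein P (fun z => gx x₀ y₀ z) Bx →
        Minimax.Bernstein P (fun z => gy x₀ y₀ z) By →
        X ⊆ Metric.closedBall x₀ R₁ →
        1 ≤ √2 * R₁ * n →
        0 < δ → δ < 1 →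
        -- the exceptional set of samples has (outer) probability at most `δ`
        Measure.pi (fun _ : Fin n => P)
          {S | ¬ ∀ x ∈ X, ∃ G GS : EuclideanSpace ℝ (Fin d),
            Minimax.HasGradOn (Minimax.primal (Minimax.popRisk P f) Y) X G x ∧
            Minimax.HasGradOn (Minimax.primal (Minimax.empRisk f S) Y) X GS x ∧
            ‖G - GS‖ ≤
              β / μ * (√(2 * (∫ z, ‖gy x₀ y₀ z‖ ^ 2 ∂P) * Real.log (8 / δ) / n)
                  + By * Real.log (8 / δ) / n)
                + (√(2 * (∫ z, ‖gx x₀ y₀ z‖ ^ 2 ∂P) * Real.log (8 / δ) / n)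
                  + Bx * Real.log (8 / δ) / n)
                + C * β * (μ + β) / μ * ((μ + β) / μ) * max ‖x - x₀‖ (1 / (n : ℝ))
                  * (√((d + Real.log (16 * Real.logb 2 (√2 * R₁ * n + 1) / δ)) / n)
                    + (d + Real.log (16 * Real.logb 2 (√2 * R₁ * n + 1) / δ)) / n)}
          ≤ ENNReal.ofReal δ := by
  refine ⟨32, by norm_num, ?_⟩
  intro d d' n Z _ P _ X Y f gx gy μ β x₀ y₀ Bx By R₁ δ h hf hsol hBx hBy hR hRn hδ hδ1
  simpa only [finrank_euclideanSpace_fin] using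
    h.measure_pi_grad_primal_sub_gt_le hf hsol hBx hBy hR hRn hδ hδ1
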